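/- There are absolute constants $0<c\le C$ such that the following holds. Consider a market with $n+1$ doctors and $n$ hospitals, in which every doctor has a ranking of the $n$ hospitals and every hospital has a ranking of the $n+1$ doctors (rank $1$ is best, and every agent prefers being matched to being unmatched); all $2n+1$ rankings are independent and uniformly random. Run the doctor-proposing deferred-acceptance algorithm: as long as some unmatched doctor has not yet proposed to every hospital, any such doctor proposes to the favourite among the hospitals not yet proposed to, and that hospital provisionally keeps its favourite of the proposer and its current partner (if any), rejecting the other. Then, with probability tending to $1$ as $n\to\infty$, for every order in which the proposals are made, the algorithm terminates and outputs a stable matching $\mu$ (a matching in which no doctor and hospital strictly prefer each other to their partners in $\mu$) in which every hospital is matched and $$ c\,\log n\;\le\;\frac1n\sum_{h}\operatorname{rank}_h(\mu(h))\;\le\; C\,\log n, \qquad c\,\frac{n}{\log n}\;\le\;\frac1n\sum_{d\text{ matched}}\operatorname{rank}_d(\mu(d))\;\le\; C\,\frac{n}{\log n}. $$ Here $\operatorname{rank}_x(y)$ is the position of $y$ in the ranking of $x$, and the second sum runs over the $n$ matched doctors. That is, hospitals rank their partners at order $\log n$ on average, and doctors rank theirs at order $n/\log n$ on average. -/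

import Mathlib

open MeasureTheory ProbabilityTheory Filter Topology

namespace StableMatching

/-- A preference profile for `m` doctors and `n` hospitals: every doctor carries a bijection from
hospitals to places, every hospital a bijection from doctors to places (smaller is better). -/
abbrev Market (m n : ℕ) : Type :=
  (Fin m → Equiv.Perm (Fin n)) × (Fin n → Equiv.Perm (Fin m))

/-- The rank, in `{1, …, n}`, of hospital `h` on the list of doctor `d`. -/
def Market.docRank {m n : ℕ} (P : Market m n) (d : Fin m) (h : Fin n) : ℕ :=
  (P.1 d h : ℕ) + 1

/-- The rank, in `{1, …, m}`, of doctor `d` on the list of hospital `h`. -/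
def Market.hospRank {m n : ℕ} (P : Market m n) (h : Fin n) (d : Fin m) : ℕ :=
  (P.2 h d : ℕ) + 1

/-! ### Matchings and stability -/

/-- `μ h` is the doctor assigned to hospital `h` (`none` if `h` is unmatched). Such an assignment
is a matching if no doctor is assigned to two hospitals. -/
def IsMatching {m n : ℕ} (μ : Fin n → Option (Fin m)) : Prop :=
  ∀ (d : Fin m) (h h' : Fin n), μ h = some d → μ h' = some d → h = h'

/-- Doctor `d` and hospital `h` strictly prefer each other to their partners in `μ`;
every agent prefers any partner to being unmatched. -/
def Market.IsBlockingPair {m n : ℕ} (P : Market m n) (μ : Fin n → Option (Fin m))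
    (d : Fin m) (h : Fin n) : Prop :=
  (∀ h', μ h' = some d → P.docRank d h < P.docRank d h') ∧
  (∀ d', μ h = some d' → P.hospRank h d < P.hospRank h d')

/-- `μ` is a matching without blocking pairs. -/
def Market.IsStable {m n : ℕ} (P : Market m n) (μ : Fin n → Option (Fin m)) : Prop :=
  IsMatching μ ∧ ∀ d h, ¬ P.IsBlockingPair μ d h

/-! ### The doctor-proposing deferred-acceptance algorithm -/

/-- A state of the algorithm: the provisional assignment and, for every doctor, the set of
hospitals that the doctor has proposed to so far. -/
structure State (m n : ℕ) where
  partner : Fin n → Option (Fin m)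
  proposed : Fin m → Finset (Fin n)

/-- At the start nobody is matched and no proposal has been made. -/
def State.init (m n : ℕ) : State m n where
  partner := fun _ => none
  proposed := fun _ => ∅

/-- Doctor `d` is currently unmatched. -/
def State.Unmatched {m n : ℕ} (s : State m n) (d : Fin m) : Prop :=
  ∀ h, s.partner h ≠ some d

/-- The doctor that hospital `h` keeps when `d` proposes to it: `d` if `h` is unmatched, and the
favourite of `d` and the current partner otherwise. -/
def Market.keeps {m n : ℕ} (P : Market m n) (h : Fin n) (d : Fin m) : Option (Fin m) → Fin m
  | none => d
  | some d' => if P.hospRank h d < P.hospRank h d' then d else d'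

/-- The effect of a proposal of doctor `d` to hospital `h`. -/
def State.afterProposal {m n : ℕ} (P : Market m n) (s : State m n) (d : Fin m) (h : Fin n) :
    State m n where
  partner := Function.update s.partner h (some (P.keeps h d (s.partner h)))
  proposed := Function.update s.proposed d (insert h (s.proposed d))

/-- One round of the loop: *some* unmatched doctor `d` who has not proposed to every hospital
proposes to the favourite `h` among the hospitals that `d` has not proposed to yet. (For an
unmatched doctor these are the hospitals that have not yet rejected the doctor.) The choice of `d`
is left open, so that every order of proposals is covered. -/
inductive Market.Step {m n : ℕ} (P : Market m n) : State m n → State m n → Prop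
  | propose (s : State m n) (d : Fin m) (h : Fin n) (unmatched : s.Unmatched d)
      (new : h ∉ s.proposed d)
      (favourite : ∀ h', h' ∉ s.proposed d → P.docRank d h ≤ P.docRank d h') :
      Market.Step P s (s.afterProposal P d h)

/-- The loop condition fails: every unmatched doctor has proposed to every hospital. -/
def State.IsFinal {m n : ℕ} (s : State m n) : Prop :=
  ∀ d, s.Unmatched d → ∀ h, h ∈ s.proposed d

/-- Some run of the algorithm ends with the assignment `μ`. -/
def Market.DAOutputs {m n : ℕ} (P : Market m n) (μ : Fin n → Option (Fin m)) : Prop :=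
  ∃ s : State m n,
    Relation.ReflTransGen P.Step (State.init m n) s ∧ s.IsFinal ∧ s.partner = μ

/-- Every run of the algorithm stops after finitely many proposals. -/
def Market.DAHalts {m n : ℕ} (P : Market m n) : Prop :=
  ∀ r : ℕ → State m n, r 0 = State.init m n → ¬ ∀ i, P.Step (r i) (r (i + 1))

/-! ### Average ranks -/

/-- The matched pairs (doctor, hospital) of `μ`. -/
def pairs {m n : ℕ} (μ : Fin n → Option (Fin m)) : Finset (Fin m × Fin n) :=
  Finset.univ.filter fun p => μ p.2 = some p.1

/-- The average, over the matched hospitals, of the rank of the assigned doctor. -/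
noncomputable def Market.avgHospRank {m n : ℕ} (P : Market m n) (μ : Fin n → Option (Fin m)) : ℝ :=
  (∑ p ∈ pairs μ, (P.hospRank p.2 p.1 : ℝ)) / ((pairs μ).card : ℝ)

/-- The average, over the matched doctors, of the rank of the assigned hospital. -/
noncomputable def Market.avgDocRank {m n : ℕ} (P : Market m n) (μ : Fin n → Option (Fin m)) : ℝ :=
  (∑ p ∈ pairs μ, (P.docRank p.1 p.2 : ℝ)) / ((pairs μ).card : ℝ)

/-! ### The random market -/

instance instMeasurableSpacePerm (k : ℕ) : MeasurableSpace (Equiv.Perm (Fin k)) := ⊤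

instance instDiscretePerm (k : ℕ) : DiscreteMeasurableSpace (Equiv.Perm (Fin k)) :=
  ⟨fun _ => trivial⟩

/-- The law of a uniformly random permutation. -/
noncomputable def uniformPerm (k : ℕ) : Measure (Equiv.Perm (Fin k)) :=
  uniformOn Set.univ

/-- The law of the random market: all preference lists are uniform and independent. -/
noncomputable def randomMarket (m n : ℕ) : Measure (Market m n) :=
  (Measure.pi fun _ : Fin m => uniformPerm n).prod (Measure.pi fun _ : Fin n => uniformPerm m)

end StableMatching

/-!
The proof is a first-moment computation over stable assignments. Every output of deferred
acceptance is a stable matching that fills all hospitals (`Market.DAOutputs.exists_embedding`), that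
is, an injection `f` of the hospitals into the doctors, leaving one doctor unmatched. It is enough
to show that, with high probability, *no* such `f` is stable and has atypical ranks.

Fix `f` and the lists of the doctors. Let `k h` be the number of doctors who prefer `h` to their
own partner (`suitors`); the unmatched doctor is always one of them. Stability says that each
hospital `h` ranks `f h` above its `k h` suitors, so it has conditional probability
`∏ h, 1 / (k h + 1) = ∏ h, ∫₀¹ (1 - y) ^ (k h) dy`. For fixed `y`, the product of the
`(1 - y h) ^ (k h)` splits over the doctors, and Maclaurin's inequality (`sum_perm_prod_lt_le`)
bounds each factor given the place of the partner. This leaves one-dimensional integrals in `y`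
(`sum_prod_integral_suitors_le`). With a Chernoff bound for the number of place vectors of sum `S`
(`card_placeVectors_le`), the expected number of stable assignments with place sum `S` on the side
of the doctors is, up to a polynomial factor, at most
`exp (-n ^ 2 / (2 (S + n))) * exp (-n exp (-n ^ 2 / S))`. This is tiny unless `S` has order
`n ^ 2 / log n`.

For such `S`, every hospital has at least of order `n / log n` suitors, except with probability
`exp (-c n / log n)`; this comes from the same computation, with a Dirac measure in place of
Lebesgue measure at one hospital. Given the lists of the doctors and stability, the ranks of the
partners of the hospitals are independent, with means of order `n / k h`, so their sum has order
`n log n` with exponentially small exceptional probability (`card_stableAt_hospSum_le`,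
`card_stableAt_le_hospSum`). All these gains beat the polynomial factors lost in the union bounds.
-/

namespace StableMatching

/-! ### Deferred acceptance -/

/-- The invariants of a run of deferred acceptance: the provisional assignment is a matching,
every partner has proposed, doctors work down their lists, and the partner of a hospital is at
least as good as every doctor who has proposed to it. -/
structure Market.Inv {m n : ℕ} (P : Market m n) (s : State m n) : Prop where
  matching : IsMatching s.partner
  partner_proposed : ∀ d h, s.partner h = some d → h ∈ s.proposed d
  initial_segment : ∀ d h h', h ∈ s.proposed d → P.docRank d h' < P.docRank d h →
    h' ∈ s.proposed d
  partner_best : ∀ d h, h ∈ s.proposed d →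
    ∃ d', s.partner h = some d' ∧ P.hospRank h d' ≤ P.hospRank h d

theorem Market.inv_init {m n : ℕ} (P : Market m n) : P.Inv (State.init m n) := by
  constructor <;> simp [State.init, IsMatching]

theorem Market.keeps_cases {m n : ℕ} (P : Market m n) (h : Fin n) (d : Fin m)
    (o : Option (Fin m)) : P.keeps h d o = d ∨ o = some (P.keeps h d o) := by
  cases o with
  | none => left; rfl
  | some d' => simp only [Market.keeps]; split_ifs <;> simp

theorem Market.keeps_le {m n : ℕ} (P : Market m n) (h : Fin n) (d : Fin m)
    (o : Option (Fin m)) : P.hospRank h (P.keeps h d o) ≤ P.hospRank h d ∧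
      ∀ d', o = some d' → P.hospRank h (P.keeps h d o) ≤ P.hospRank h d' := by
  cases o with
  | none => simp [Market.keeps]
  | some d' =>
    simp only [Market.keeps, Option.some.injEq, forall_eq']
    split_ifs <;> constructor <;> omega

theorem Market.Inv.step {m n : ℕ} {P : Market m n} {s t : State m n} (hs : P.Inv s)
    (hst : P.Step s t) : P.Inv t := by
  obtain ⟨d, h, unmatched, new, favourite⟩ := hst
  have hprop : ∀ e g, g ∈ s.proposed e → g ∈ (s.afterProposal P d h).proposed e := by
    intro e g hg
    by_cases hed : e = d
    · subst hed; simp [State.afterProposal, hg]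
    · simpa [State.afterProposal, Function.update_of_ne hed] using hg
  have hself : h ∈ (s.afterProposal P d h).proposed d := by simp [State.afterProposal]
  have hpart : ∀ g, g ≠ h → (s.afterProposal P d h).partner g = s.partner g := by
    intro g hg; simp [State.afterProposal, Function.update_of_ne hg]
  have hparth : (s.afterProposal P d h).partner h = some (P.keeps h d (s.partner h)) := by
    simp [State.afterProposal]
  have hmem : ∀ e g, g ∈ (s.afterProposal P d h).proposed e →
      g ∈ s.proposed e ∨ (e = d ∧ g = h) := by
    intro e g hg
    by_cases hed : e = d
    · subst hed
      simp only [State.afterProposal, Function.update_self, Finset.mem_insert] at hg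
      tauto
    · left; simpa [State.afterProposal, Function.update_of_ne hed] using hg
  have key : ∀ e g, (s.afterProposal P d h).partner g = some e →
      s.partner g = some e ∨ (e = d ∧ g = h) := by
    intro e g hg
    by_cases hgh : g = h
    · subst hgh
      rw [hparth, Option.some.injEq] at hg
      rcases P.keeps_cases g d (s.partner g) with h1 | h1
      · right; exact ⟨by rw [← hg, h1], rfl⟩
      · left; rw [h1, hg]
    · left; rw [← hpart g hgh, hg]
  refine ⟨?_, ?_, ?_, ?_⟩
  · intro e g g' h1 h2
    rcases key e g h1 with k1 | ⟨k1, k1'⟩ <;> rcases key e g' h2 with k2 | ⟨k2, k2'⟩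
    · exact hs.matching e g g' k1 k2
    · subst k2; exact absurd k1 (unmatched g)
    · subst k1; exact absurd k2 (unmatched g')
    · rw [k1', k2']
  · intro e g hg
    rcases key e g hg with h1 | ⟨rfl, rfl⟩
    · exact hprop _ _ (hs.partner_proposed _ _ h1)
    · exact hself
  · intro e g g' hg hlt
    rcases hmem e g hg with h1 | ⟨rfl, rfl⟩
    · exact hprop _ _ (hs.initial_segment _ _ _ h1 hlt)
    · by_contra hcon
      have : g' ∉ s.proposed e := fun hc => hcon (hprop _ _ hc)
      have := favourite g' this
      omega
  · intro e g hg
    have hle := P.keeps_le h d (s.partner h)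
    rcases hmem e g hg with h1 | ⟨rfl, rfl⟩
    · obtain ⟨d', hd', hr⟩ := hs.partner_best e g h1
      by_cases hgh : g = h
      · subst hgh
        exact ⟨_, hparth, (hle.2 d' hd').trans hr⟩
      · exact ⟨d', by rw [hpart g hgh, hd'], hr⟩
    · exact ⟨_, hparth, hle.1⟩

theorem Market.inv_of_reachable {m n : ℕ} {P : Market m n} {s : State m n}
    (hs : Relation.ReflTransGen P.Step (State.init m n) s) : P.Inv s := by
  induction hs with
  | refl => exact P.inv_init
  | tail _ hst ih => exact ih.step hst

theorem Market.Inv.isStable {m n : ℕ} {P : Market m n} {s : State m n} (hs : P.Inv s)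
    (hf : s.IsFinal) : P.IsStable s.partner := by
  refine ⟨hs.matching, ?_⟩
  rintro d h ⟨h1, h2⟩
  have hnot : h ∉ s.proposed d := by
    intro hp
    obtain ⟨d', hd', hr⟩ := hs.partner_best d h hp
    have := h2 d' hd'
    omega
  by_cases hu : s.Unmatched d
  · exact hnot (hf d hu h)
  · simp only [State.Unmatched, not_forall, not_not] at hu
    obtain ⟨h', hh'⟩ := hu
    exact hnot (hs.initial_segment d h' h (hs.partner_proposed _ _ hh') (h1 h' hh'))

theorem State.exists_unmatched {n : ℕ} (s : State (n + 1) n) : ∃ d, s.Unmatched d := by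
  by_contra hcon
  simp only [State.Unmatched, not_exists, not_forall, not_not] at hcon
  choose g hg using hcon
  have hinj : Function.Injective g := by
    intro d d' hdd
    have h1 := hg d
    rw [hdd, hg d'] at h1
    exact (Option.some.inj h1).symm
  have := Fintype.card_le_of_injective g hinj
  simp at this

theorem Market.Inv.exists_partner {n : ℕ} {P : Market (n + 1) n} {s : State (n + 1) n}
    (hs : P.Inv s) (hf : s.IsFinal) (h : Fin n) : ∃ d, s.partner h = some d := by
  obtain ⟨d, hd⟩ := s.exists_unmatched
  obtain ⟨d', hd', _⟩ := hs.partner_best d h (hf d hd h)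
  exact ⟨d', hd'⟩

/-- The number of proposals made so far. -/
def State.numProposals {m n : ℕ} (s : State m n) : ℕ := ∑ d, (s.proposed d).card

theorem State.numProposals_le {m n : ℕ} (s : State m n) : s.numProposals ≤ m * n := by
  have : s.numProposals ≤ ∑ _d : Fin m, n :=
    Finset.sum_le_sum fun d _ => by simpa using Finset.card_le_univ (s.proposed d)
  simpa using this

theorem Market.Step.numProposals_lt {m n : ℕ} {P : Market m n} {s t : State m n}
    (h : P.Step s t) : s.numProposals < t.numProposals := by
  obtain ⟨d, h, unmatched, new, favourite⟩ := h
  refine Finset.sum_lt_sum (fun e _ => ?_) ⟨d, Finset.mem_univ d, ?_⟩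
  · by_cases hed : e = d
    · subst hed
      simp only [State.afterProposal, Function.update_self]
      exact Finset.card_le_card (Finset.subset_insert _ _)
    · simp [State.afterProposal, Function.update_of_ne hed]
  · simp [State.afterProposal, Finset.card_insert_of_notMem new]

theorem Market.daHalts {m n : ℕ} (P : Market m n) : P.DAHalts := by
  intro r _ hr
  have hge : ∀ i, i ≤ (r i).numProposals := by
    intro i
    induction i with
    | zero => exact Nat.zero_le _
    | succ i ih => have := (hr i).numProposals_lt; omega
  have h1 := hge (m * n + 1)
  have h2 := (r (m * n + 1)).numProposals_le
  omega

theorem Market.exists_step {m n : ℕ} (P : Market m n) {s : State m n} (hs : ¬ s.IsFinal) :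
    ∃ t, P.Step s t := by
  simp only [State.IsFinal, not_forall] at hs
  obtain ⟨d, hd, h, hh⟩ := hs
  obtain ⟨g, hg, hmin⟩ := Finset.exists_min_image (s.proposed d)ᶜ (fun g => P.docRank d g)
    ⟨h, by simpa using hh⟩
  exact ⟨_, .propose s d g hd (by simpa using hg) fun h' hh' => hmin h' (by simpa using hh')⟩

theorem Market.exists_daOutputs {m n : ℕ} (P : Market m n) : ∃ μ, P.DAOutputs μ := by
  suffices H : ∀ k (s : State m n), m * n - s.numProposals = k →
      ∃ t, Relation.ReflTransGen P.Step s t ∧ t.IsFinal by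
    obtain ⟨t, h1, h2⟩ := H _ (State.init m n) rfl
    exact ⟨_, t, h1, h2, rfl⟩
  intro k
  induction k using Nat.strong_induction_on with
  | _ k ih =>
    intro s hk
    by_cases hf : s.IsFinal
    · exact ⟨s, .refl, hf⟩
    · obtain ⟨t, ht⟩ := P.exists_step hf
      have h1 := ht.numProposals_lt
      have h2 := t.numProposals_le
      obtain ⟨u, hu, huf⟩ := ih (m * n - t.numProposals) (by omega) t rfl
      exact ⟨u, .head ht hu, huf⟩

/-- An output of the algorithm is an injection of the hospitals into the doctors, and it is
stable. -/
theorem Market.DAOutputs.exists_embedding {n : ℕ} {P : Market (n + 1) n}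
    {μ : Fin n → Option (Fin (n + 1))} (hμ : P.DAOutputs μ) :
    P.IsStable μ ∧ ∃ f : Fin n ↪ Fin (n + 1), μ = fun h => some (f h) := by
  obtain ⟨s, hreach, hf, rfl⟩ := hμ
  have hinv := Market.inv_of_reachable hreach
  choose f hfe using hinv.exists_partner hf
  refine ⟨hinv.isStable hf, ⟨f, fun h h' hh => ?_⟩, funext hfe⟩
  exact hinv.matching (f h) h h' (hfe h) (by rw [hfe h', hh])

/-! ### Uniformly random permutations -/

open Equiv in
theorem sum_perm_mul_swap {m : ℕ} {b p s t : Fin m} (hs : s ≠ b) (ht : t ≠ b)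
    (G : Perm (Fin m) → ℝ) :
    ∑ τ : Perm (Fin m) with τ b = p, G (τ * swap s t) = ∑ τ : Perm (Fin m) with τ b = p, G τ := by
  rw [Finset.sum_filter, Finset.sum_filter,
    ← Equiv.sum_comp (Equiv.mulRight (swap s t)) fun τ => if τ b = p then G τ else 0]
  refine Finset.sum_congr rfl fun τ _ => ?_
  simp [swap_apply_of_ne_of_ne hs.symm ht.symm]

open Equiv in
theorem card_perm_apply_eq {m : ℕ} (b p : Fin m) :
    ((Finset.univ.filter fun τ : Perm (Fin m) => τ b = p).card : ℝ) = ((m - 1).factorial : ℝ) := by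
  have hconst : ∀ q : Fin m, (Finset.univ.filter fun τ : Perm (Fin m) => τ b = q).card =
      (Finset.univ.filter fun τ : Perm (Fin m) => τ b = p).card := by
    intro q
    refine Finset.card_bij (fun τ _ => swap p q * τ) ?_ ?_ ?_
    · intro τ hτ; simp at hτ; simp [hτ]
    · intro τ _ τ' _ h; exact mul_left_cancel h
    · intro τ hτ
      simp at hτ
      exact ⟨swap p q * τ, by simp [hτ], by simp [← mul_assoc]⟩
  have hsum : ∑ q : Fin m, (Finset.univ.filter fun τ : Perm (Fin m) => τ b = q).card =
      m.factorial := by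
    rw [← Finset.card_eq_sum_card_fiberwise (fun _ _ => Finset.mem_univ _)]
    simp [Fintype.card_perm]
  simp only [hconst, Finset.sum_const, Finset.card_univ, Fintype.card_fin, smul_eq_mul] at hsum
  have hm : 0 < m := b.pos
  rw [← Nat.mul_factorial_pred hm.ne'] at hsum
  exact_mod_cast Nat.eq_of_mul_eq_mul_left hm hsum

open Equiv in
/-- One step of Maclaurin's inequality for the elementary symmetric means, in permutation form:
among the products `w (τ 0) ⋯ w (τ (c - 1)) * w (τ s)`, the choice `s = c` has the smallest
average. For `s < c` this is `x * y ≤ (x ^ 2 + y ^ 2) / 2` together with exchangeability. -/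
theorem sum_perm_prod_succ_le {m : ℕ} (b p : Fin m) (w : Fin m → ℝ) (hw : ∀ j, 0 ≤ w j)
    {c : ℕ} (hc : c < b) :
    ((m : ℝ) - 1) * ∑ τ : Perm (Fin m) with τ b = p,
        ∏ t ∈ Finset.univ.filter (fun t : Fin m => (t : ℕ) < c + 1), w (τ t) ≤
      (∑ j ∈ Finset.univ.erase p, w j) * ∑ τ : Perm (Fin m) with τ b = p,
        ∏ t ∈ Finset.univ.filter (fun t : Fin m => (t : ℕ) < c), w (τ t) := by
  have hm := b.isLt
  let i : Fin m := ⟨c, by omega⟩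
  have hib : i ≠ b := by intro h; rw [← h] at hc; simp [i] at hc
  have hset : (Finset.univ.filter fun t : Fin m => (t : ℕ) < c + 1) =
      insert i (Finset.univ.filter fun t : Fin m => (t : ℕ) < c) := by
    ext t; simp [Fin.ext_iff, i]; omega
  have hni : i ∉ Finset.univ.filter fun t : Fin m => (t : ℕ) < c := by simp [i]
  simp only [hset, Finset.prod_insert hni]
  set F := ∑ τ : Perm (Fin m) with τ b = p,
    w (τ i) * ∏ t ∈ Finset.univ.filter (fun t : Fin m => (t : ℕ) < c), w (τ t) with hF
  have hW : ∀ τ ∈ Finset.univ.filter (fun τ : Perm (Fin m) => τ b = p),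
      ∑ j ∈ Finset.univ.erase p, w j = ∑ s ∈ Finset.univ.erase b, w (τ s) := by
    intro τ hτ
    simp at hτ
    symm
    refine Finset.sum_nbij τ ?_ τ.injective.injOn ?_ (fun _ _ => rfl)
    · intro s hs; simp at hs ⊢; rw [← hτ]; exact fun h => hs (τ.injective h)
    · intro j hj
      simp at hj
      refine ⟨τ.symm j, ?_, by simp⟩
      have : τ.symm j ≠ b := by intro h; apply hj; rw [← hτ, ← h]; simp
      simpa using this
  have hR : (∑ j ∈ Finset.univ.erase p, w j) * ∑ τ : Perm (Fin m) with τ b = p,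
        ∏ t ∈ Finset.univ.filter (fun t : Fin m => (t : ℕ) < c), w (τ t) =
      ∑ s ∈ Finset.univ.erase b, ∑ τ : Perm (Fin m) with τ b = p,
        w (τ s) * ∏ t ∈ Finset.univ.filter (fun t : Fin m => (t : ℕ) < c), w (τ t) := by
    rw [Finset.sum_comm, Finset.mul_sum]
    refine Finset.sum_congr rfl fun τ hτ => ?_
    rw [hW τ hτ, Finset.sum_mul]
  rw [hR]
  have hcard : ((m : ℝ) - 1) * F = ∑ s ∈ Finset.univ.erase b, F := by
    rw [Finset.sum_const, Finset.card_erase_of_mem (Finset.mem_univ _), Finset.card_univ,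
      Fintype.card_fin, nsmul_eq_mul, Nat.cast_sub (by omega), Nat.cast_one]
  rw [hcard]
  refine Finset.sum_le_sum fun s hs => ?_
  have hsb : s ≠ b := Finset.ne_of_mem_erase hs
  by_cases hsc : (s : ℕ) < c
  · have hsi : s ≠ i := by intro h; rw [h] at hsc; simp [i] at hsc
    set T := (Finset.univ.filter fun t : Fin m => (t : ℕ) < c).erase s with hT
    have hprod : ∀ τ : Perm (Fin m),
        ∏ t ∈ Finset.univ.filter (fun t : Fin m => (t : ℕ) < c), w (τ t) =
        w (τ s) * ∏ t ∈ T, w (τ t) := by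
      intro τ
      rw [hT, Finset.mul_prod_erase _ (fun t => w (τ t)) (by simp [hsc])]
    have hswap : ∑ τ : Perm (Fin m) with τ b = p, w (τ i) * (w (τ i) * ∏ t ∈ T, w (τ t)) =
        ∑ τ : Perm (Fin m) with τ b = p, w (τ s) * (w (τ s) * ∏ t ∈ T, w (τ t)) := by
      rw [← sum_perm_mul_swap hib hsb]
      refine Finset.sum_congr rfl fun τ _ => ?_
      have : ∏ t ∈ T, w ((τ * swap i s) t) = ∏ t ∈ T, w (τ t) := by
        refine Finset.prod_congr rfl fun t ht => ?_
        have h1 : t ≠ s := by rw [hT] at ht; exact Finset.ne_of_mem_erase ht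
        have h2 : t ≠ i := by
          rintro rfl; rw [hT] at ht; exact hni (Finset.mem_of_mem_erase ht)
        simp [swap_apply_of_ne_of_ne h2 h1]
      rw [this]; simp
    have h2F : 2 * F ≤ 2 * ∑ τ : Perm (Fin m) with τ b = p,
        w (τ s) * (w (τ s) * ∏ t ∈ T, w (τ t)) := by
      nth_rewrite 2 [two_mul]
      nth_rewrite 1 [← hswap]
      rw [hF, ← Finset.sum_add_distrib, Finset.mul_sum]
      refine Finset.sum_le_sum fun τ _ => ?_
      rw [hprod]
      have : 0 ≤ ∏ t ∈ T, w (τ t) := Finset.prod_nonneg fun _ _ => hw _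
      nlinarith [mul_nonneg this (sq_nonneg (w (τ i) - w (τ s)))]
    simp only [hprod]
    linarith
  · rw [← sum_perm_mul_swap hib hsb]
    refine le_of_eq (Finset.sum_congr rfl fun τ _ => ?_)
    have : ∏ t ∈ Finset.univ.filter (fun t : Fin m => (t : ℕ) < c), w ((τ * swap i s) t) =
        ∏ t ∈ Finset.univ.filter (fun t : Fin m => (t : ℕ) < c), w (τ t) := by
      refine Finset.prod_congr rfl fun t ht => ?_
      simp at ht
      have h1 : t ≠ s := by rintro rfl; exact hsc ht
      have h2 : t ≠ i := by rintro rfl; simp [i] at ht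
      simp [swap_apply_of_ne_of_ne h2 h1]
    rw [this]; simp

open Equiv in
/-- Maclaurin's inequality for the elements that a uniformly random permutation places before
`p`, given the place `b` of `p`: their weights multiply up to at most the `b`-th power of the
average weight. -/
theorem sum_perm_prod_lt_le {m : ℕ} (hm : 2 ≤ m) (p b : Fin m) (w : Fin m → ℝ)
    (hw : ∀ j, 0 ≤ w j) :
    ∑ σ : Perm (Fin m) with σ p = b, ∏ j : Fin m with σ j < σ p, w j ≤
      ((m - 1).factorial : ℝ) * ((∑ j ∈ Finset.univ.erase p, w j) / ((m : ℝ) - 1)) ^ (b : ℕ) := by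
  have hinv : ∑ σ : Perm (Fin m) with σ p = b, ∏ j : Fin m with σ j < σ p, w j =
      ∑ τ : Perm (Fin m) with τ b = p,
        ∏ t ∈ Finset.univ.filter (fun t : Fin m => (t : ℕ) < (b : ℕ)), w (τ t) := by
    rw [Finset.sum_filter, Finset.sum_filter, ← Equiv.sum_comp (Equiv.inv (Perm (Fin m)))]
    refine Finset.sum_congr rfl fun τ _ => ?_
    have hiff : (Equiv.inv (Perm (Fin m)) τ) p = b ↔ τ b = p := by
      show τ⁻¹ p = b ↔ τ b = p
      rw [Perm.inv_eq_iff_eq, eq_comm]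
    simp only [hiff]
    split_ifs with h
    · symm
      refine Finset.prod_nbij τ ?_ τ.injective.injOn ?_ (fun _ _ => rfl)
      · intro t ht
        simp only [Finset.mem_filter, Finset.mem_univ, true_and] at ht ⊢
        simpa [← h] using ht
      · intro j hj
        simp only [Finset.coe_filter, Finset.mem_univ, true_and, Set.mem_ofPred_eq] at hj
        refine ⟨τ⁻¹ j, ?_, by simp⟩
        simpa [← h] using hj
    · rfl
  rw [hinv]
  have hm1 : (0 : ℝ) < (m : ℝ) - 1 := by
    have : (2 : ℝ) ≤ m := by exact_mod_cast hm
    linarith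
  have hW : 0 ≤ ∑ j ∈ Finset.univ.erase p, w j := Finset.sum_nonneg fun _ _ => hw _
  have key : ∀ c : ℕ, c ≤ b → ∑ τ : Perm (Fin m) with τ b = p,
      ∏ t ∈ Finset.univ.filter (fun t : Fin m => (t : ℕ) < c), w (τ t) ≤
      ((m - 1).factorial : ℝ) * ((∑ j ∈ Finset.univ.erase p, w j) / ((m : ℝ) - 1)) ^ c := by
    intro c
    induction c with
    | zero => intro _; simp [card_perm_apply_eq]
    | succ c ih =>
      intro hc
      have h1 := sum_perm_prod_succ_le b p w hw (c := c) (by omega)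
      have h2 := ih (by omega)
      rw [mul_comm, ← le_div_iff₀ hm1] at h1
      refine h1.trans ?_
      rw [pow_succ, mul_div_right_comm, ← mul_assoc, mul_comm _ (_ / _)]
      exact mul_le_mul_of_nonneg_left h2 (div_nonneg hW hm1.le)
  exact key b le_rfl

open Equiv in
/-- In a uniformly random permutation, `p` comes before all of `D` with probability
`1 / (#D + 1)`: each element of `insert p D` is equally likely to come first. -/
theorem card_perm_lt_all {m : ℕ} (p : Fin m) (D : Finset (Fin m)) (hp : p ∉ D) :
    ((Finset.univ.filter fun τ : Perm (Fin m) => ∀ d ∈ D, τ p < τ d).card : ℝ) =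
      (m.factorial : ℝ) / (D.card + 1) := by
  set A : Fin m → Finset (Perm (Fin m)) := fun q =>
    Finset.univ.filter fun τ : Perm (Fin m) => ∀ d ∈ insert p D, τ q ≤ τ d with hA
  have hAp : (Finset.univ.filter fun τ : Perm (Fin m) => ∀ d ∈ D, τ p < τ d) = A p := by
    ext τ
    simp only [hA, Finset.mem_filter, Finset.mem_univ, true_and, Finset.mem_insert,
      forall_eq_or_imp, le_refl]
    refine forall₂_congr fun d hd => ?_
    have : τ p ≠ τ d := fun h => hp (by rw [τ.injective h]; exact hd)
    exact ⟨le_of_lt, fun h => lt_of_le_of_ne h this⟩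
  have hcard : ∀ q ∈ insert p D, (A q).card = (A p).card := by
    intro q hq
    have hmem : ∀ d, d ∈ insert p D → swap p q d ∈ insert p D := by
      intro d hd
      by_cases h1 : d = p
      · subst h1; simpa using hq
      by_cases h2 : d = q
      · subst h2; simp
      · rwa [swap_apply_of_ne_of_ne h1 h2]
    refine Finset.card_bij (fun τ _ => τ * swap p q) ?_ ?_ ?_
    · intro τ hτ
      simp only [hA, Finset.mem_filter, Finset.mem_univ, true_and] at hτ ⊢
      intro d hd
      simpa using hτ _ (hmem d hd)
    · intro τ _ τ' _ h; exact mul_right_cancel h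
    · intro τ hτ
      refine ⟨τ * swap p q, ?_, by simp [mul_assoc]⟩
      simp only [hA, Finset.mem_filter, Finset.mem_univ, true_and] at hτ ⊢
      intro d hd
      simpa using hτ _ (hmem d hd)
  have hunion : (insert p D).biUnion A = Finset.univ := by
    ext τ
    simp only [Finset.mem_biUnion, Finset.mem_univ, iff_true]
    obtain ⟨q, hq, hmin⟩ := Finset.exists_min_image (insert p D) τ ⟨p, by simp⟩
    exact ⟨q, hq, by simpa [hA] using hmin⟩
  have hdisj : ((insert p D : Finset (Fin m)) : Set (Fin m)).PairwiseDisjoint A := by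
    intro q hq r hr hqr
    rw [Function.onFun, Finset.disjoint_left]
    intro τ h1 h2
    simp only [hA, Finset.mem_filter, Finset.mem_univ, true_and] at h1 h2
    exact hqr (τ.injective (le_antisymm (h1 r hr) (h2 q hq)))
  have := Finset.card_biUnion hdisj
  rw [hunion, Finset.sum_congr rfl hcard, Finset.sum_const, Finset.card_univ, Fintype.card_perm,
    Fintype.card_fin, Finset.card_insert_of_notMem hp, smul_eq_mul] at this
  rw [hAp, eq_div_iff (by positivity), mul_comm]
  exact_mod_cast this.symm

open Equiv in
/-- The generating function of the place of `p` on the event that `p` comes before all of `D`.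
The bound is a geometric series, from `sum_perm_prod_lt_le` with the indicator of the complement of
`D` as weight. -/
theorem sum_perm_lt_all_pow_le {n : ℕ} (hn : 1 ≤ n) (p : Fin (n + 1)) (D : Finset (Fin (n + 1)))
    (hp : p ∉ D) {s : ℝ} (hs : 0 ≤ s) (hs1 : s * (1 - D.card / n) < 1) :
    ∑ τ : Perm (Fin (n + 1)) with ∀ d ∈ D, τ p < τ d, s ^ (τ p : ℕ) ≤
      (n.factorial : ℝ) / (1 - s * (1 - D.card / n)) := by
  have hn0 : (0 : ℝ) < n := by exact_mod_cast hn
  have hcard : D.card ≤ n := by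
    have := Finset.card_le_univ (insert p D)
    rw [Finset.card_insert_of_notMem hp] at this
    simpa using this
  have hDn : (D.card : ℝ) ≤ n := by exact_mod_cast hcard
  set x : ℝ := 1 - D.card / n with hx
  have hx0 : 0 ≤ x := by rw [hx, sub_nonneg, div_le_one hn0]; exact hDn
  set w : Fin (n + 1) → ℝ := fun j => if j ∈ D then 0 else 1 with hw
  have hw0 : ∀ j, 0 ≤ w j := fun j => by simp only [hw]; split_ifs <;> norm_num
  have hmean : (∑ j ∈ Finset.univ.erase p, w j) / (((n + 1 : ℕ) : ℝ) - 1) = x := by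
    have h1 : ∑ j ∈ Finset.univ.erase p, w j = n - D.card := by
      have h2 : ∑ j ∈ Finset.univ.erase p, (1 - w j) = D.card := by
        have h3 : ∀ j, 1 - w j = if j ∈ D then 1 else 0 := by
          intro j; simp only [hw]; split_ifs <;> norm_num
        simp only [h3, Finset.sum_ite_mem, Finset.sum_const, nsmul_eq_mul, mul_one]
        congr 2
        ext j; simp; rintro hj rfl; exact hp hj
      rw [Finset.sum_sub_distrib] at h2
      have h4 : ∑ j ∈ Finset.univ.erase p, (1 : ℝ) = n := by
        rw [Finset.sum_const, Finset.card_erase_of_mem (Finset.mem_univ _)]; simp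
      linarith
    rw [h1, hx, Nat.cast_succ, add_sub_cancel_right, sub_div, div_self hn0.ne']
  have hprod : ∀ τ : Perm (Fin (n + 1)), (∏ j : Fin (n + 1) with τ j < τ p, w j) =
      if ∀ d ∈ D, τ p < τ d then 1 else 0 := by
    intro τ
    split_ifs with h
    · refine Finset.prod_eq_one fun j hj => ?_
      simp at hj
      simp only [hw, ite_eq_right_iff]
      intro hjD; exact absurd (h j hjD) (not_lt.mpr hj.le)
    · push Not at h
      obtain ⟨d, hd, hle⟩ := h
      refine Finset.prod_eq_zero (i := d) ?_ (by simp [hw, hd])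
      simp
      exact lt_of_le_of_ne hle fun h => hp (by rw [← τ.injective h]; exact hd)
  have hsplit : ∑ τ : Perm (Fin (n + 1)) with ∀ d ∈ D, τ p < τ d, s ^ (τ p : ℕ) =
      ∑ b : Fin (n + 1), s ^ (b : ℕ) * ∑ τ : Perm (Fin (n + 1)) with τ p = b,
        ∏ j : Fin (n + 1) with τ j < τ p, w j := by
    rw [Finset.sum_filter, ← Finset.sum_fiberwise_of_maps_to
      (fun τ _ => Finset.mem_univ ((τ : Perm (Fin (n + 1))) p))]
    refine Finset.sum_congr rfl fun b _ => ?_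
    rw [Finset.mul_sum]
    refine Finset.sum_congr rfl fun τ hτ => ?_
    simp at hτ
    rw [hprod, ← hτ]
    split_ifs <;> simp
  rw [hsplit]
  have hgeom : ∑ b ∈ Finset.range (n + 1), (s * x) ^ b ≤ 1 / (1 - s * x) := by
    rw [geom_sum_eq hs1.ne, ← neg_div_neg_eq, neg_sub, neg_sub]
    have : 0 ≤ (s * x) ^ (n + 1) := pow_nonneg (mul_nonneg hs hx0) _
    exact div_le_div_of_nonneg_right (by linarith) (by linarith)
  calc _ ≤ ∑ b : Fin (n + 1), (n.factorial : ℝ) * (s * x) ^ (b : ℕ) := by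
        refine Finset.sum_le_sum fun b _ => ?_
        have := sum_perm_prod_lt_le (by omega) p b w hw0
        rw [hmean, Nat.add_sub_cancel] at this
        calc _ ≤ s ^ (b : ℕ) * (n.factorial * x ^ (b : ℕ)) :=
              mul_le_mul_of_nonneg_left this (pow_nonneg hs _)
          _ = _ := by rw [mul_pow]; ring
    _ = n.factorial * ∑ b ∈ Finset.range (n + 1), (s * x) ^ b := by
        rw [← Finset.mul_sum, ← Fin.sum_univ_eq_sum_range fun b => (s * x) ^ b]
    _ ≤ n.factorial * (1 / (1 - s * x)) := by gcongr
    _ = _ := by rw [mul_one_div]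

/-! ### Averaging over the preferences of the doctors -/

/-- The doctors who prefer `h` to their own partner, when hospital `g` is matched with `f g`;
an unmatched doctor prefers every hospital. -/
def suitors {m n : ℕ} (p : Fin m → Equiv.Perm (Fin n)) (f : Fin n ↪ Fin m) (h : Fin n) :
    Finset (Fin m) :=
  Finset.univ.filter fun d => ∀ h', f h' = d → p d h < p d h'

/-- The sum of the places, counted from `0`, that the matched doctors give to their partners. -/
def placeSum {m n : ℕ} (p : Fin m → Equiv.Perm (Fin n)) (f : Fin n ↪ Fin m) : ℕ :=
  ∑ h, (p (f h) h : ℕ)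

theorem mem_suitors_apply {m n : ℕ} (p : Fin m → Equiv.Perm (Fin n)) (f : Fin n ↪ Fin m)
    (h g : Fin n) : f g ∈ suitors p f h ↔ p (f g) h < p (f g) g := by
  simp [suitors]

theorem notMem_suitors_self {m n : ℕ} (p : Fin m → Equiv.Perm (Fin n)) (f : Fin n ↪ Fin m)
    (h : Fin n) : f h ∉ suitors p f h := by
  simp [mem_suitors_apply]

theorem exists_unmatched_doctor {n : ℕ} (f : Fin n ↪ Fin (n + 1)) :
    ∃ d₀, (∀ h, f h ≠ d₀) ∧ Finset.univ = insert d₀ (Finset.univ.map f) := by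
  have hcard : ((Finset.univ.map f)ᶜ).card = 1 := by
    rw [Finset.card_compl, Finset.card_map]; simp
  obtain ⟨d₀, hd₀⟩ := Finset.card_eq_one.mp hcard
  refine ⟨d₀, fun h hh => ?_, ?_⟩
  · have : d₀ ∈ (Finset.univ.map f)ᶜ := by simp [hd₀]
    simp at this
    exact this h hh
  · ext d
    by_cases hd : d ∈ Finset.univ.map f
    · simp [hd]
    · have : d ∈ (Finset.univ.map f)ᶜ := by simpa using hd
      rw [hd₀, Finset.mem_singleton] at this
      simp [this]

theorem notMem_map_of_forall_ne {n : ℕ} {f : Fin n ↪ Fin (n + 1)} {d₀ : Fin (n + 1)}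
    (h₀ : ∀ h, f h ≠ d₀) : d₀ ∉ Finset.univ.map f := by
  simpa using h₀

theorem sum_card_suitors {n : ℕ} (p : Fin (n + 1) → Equiv.Perm (Fin n))
    (f : Fin n ↪ Fin (n + 1)) : ∑ h, (suitors p f h).card = n + placeSum p f := by
  obtain ⟨d₀, h₀, huniv⟩ := exists_unmatched_doctor f
  have h1 : ∑ h, (suitors p f h).card =
      ∑ d, (Finset.univ.filter fun h => d ∈ suitors p f h).card := by
    simp only [Finset.card_eq_sum_ones, Finset.sum_filter]
    rw [Finset.sum_comm]
    refine Finset.sum_congr rfl fun h _ => ?_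
    rw [← Finset.sum_filter]; simp
  rw [h1, huniv, Finset.sum_insert (notMem_map_of_forall_ne h₀), Finset.sum_map, placeSum]
  congr 1
  · simp [suitors, h₀]
  · refine Finset.sum_congr rfl fun g _ => ?_
    simp only [mem_suitors_apply]
    rw [← Fin.card_Iio (p (f g) g), ← Finset.card_map (p (f g)).toEmbedding]
    congr 1
    ext j
    simp

open Equiv in
/-- The suitor counts enter multiplicatively over the doctors, so independence and
`sum_perm_prod_lt_le` bound their joint generating function, given the places `a h` that the
matched doctors give to their partners. -/
theorem sum_prod_pow_suitors_le {n : ℕ} (hn : 2 ≤ n) (f : Fin n ↪ Fin (n + 1))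
    (a : Fin n → Fin n) (y : Fin n → ℝ) (hy : ∀ h, y h ∈ Set.Icc (0 : ℝ) 1) :
    ∑ p : Fin (n + 1) → Perm (Fin n) with ∀ h, p (f h) h = a h,
        ∏ h, (1 - y h) ^ (suitors p f h).card ≤
      (n.factorial : ℝ) * ((n - 1).factorial : ℝ) ^ n *
        ∏ h, Real.exp (-(y h * (1 + (∑ i, (a i : ℝ) - a h) / ((n : ℝ) - 1)))) := by
  obtain ⟨d₀, h₀, huniv⟩ := exists_unmatched_doctor f
  have hn1 : (0 : ℝ) < (n : ℝ) - 1 := by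
    have : (2 : ℝ) ≤ n := by exact_mod_cast hn
    linarith
  have hw : ∀ h, 0 ≤ 1 - y h := fun h => by linarith [(hy h).2]
  -- The contribution of doctor `d` with list `σ`; for an unmatched `d` both conditions are void.
  set G : Fin (n + 1) → Perm (Fin n) → ℝ := fun d σ =>
    if ∀ h, f h = d → σ h = a h then
      ∏ h ∈ Finset.univ.filter (fun h => ∀ h', f h' = d → σ h < σ h'), (1 - y h) else 0 with hG
  have hterm : ∀ p : Fin (n + 1) → Perm (Fin n),
      (if ∀ h, p (f h) h = a h then ∏ h, (1 - y h) ^ (suitors p f h).card else 0) =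
        ∏ d, G d (p d) := by
    intro p
    split_ifs with hp
    · have h1 : ∀ d, G d (p d) = ∏ h, if d ∈ suitors p f h then (1 - y h) else 1 := by
        intro d
        rw [hG]
        simp only
        rw [if_pos (by rintro h rfl; exact hp h), Finset.prod_filter]
        simp [suitors]
      simp only [h1]
      rw [Finset.prod_comm]
      refine Finset.prod_congr rfl fun h _ => ?_
      rw [← Finset.prod_filter, Finset.prod_const]
      simp
    · push Not at hp
      obtain ⟨h, hh⟩ := hp
      symm
      refine Finset.prod_eq_zero (Finset.mem_univ (f h)) ?_
      rw [hG]
      simp only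
      rw [if_neg]
      intro hc
      exact hh (hc h rfl)
  have hsum : ∑ p : Fin (n + 1) → Perm (Fin n) with ∀ h, p (f h) h = a h,
        ∏ h, (1 - y h) ^ (suitors p f h).card = ∏ d, ∑ σ, G d σ := by
    rw [Finset.sum_filter, Finset.prod_univ_sum, Fintype.piFinset_univ]
    exact Finset.sum_congr rfl fun p _ => hterm p
  have hG₀ : ∑ σ, G d₀ σ ≤ n.factorial * ∏ h, Real.exp (-y h) := by
    have h1 : ∀ σ, G d₀ σ = ∏ h, (1 - y h) := by
      intro σ; simp [hG, h₀]
    simp only [h1, Finset.sum_const, Finset.card_univ, Fintype.card_perm, Fintype.card_fin,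
      nsmul_eq_mul]
    gcongr with h
    · intro h _; exact hw h
    · exact Real.one_sub_le_exp_neg _
  have hGf : ∀ g, ∑ σ, G (f g) σ ≤
      (n - 1).factorial * Real.exp (-((∑ h, y h - y g) / ((n : ℝ) - 1) * a g)) := by
    intro g
    have h1 : ∑ σ, G (f g) σ =
        ∑ σ : Perm (Fin n) with σ g = a g, ∏ j : Fin n with σ j < σ g, (1 - y j) := by
      rw [Finset.sum_filter]
      refine Finset.sum_congr rfl fun σ _ => ?_
      simp [hG]
    rw [h1]
    refine (sum_perm_prod_lt_le hn g (a g) _ hw).trans ?_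
    gcongr
    have h2 : ∑ j ∈ Finset.univ.erase g, (1 - y j) = ((n : ℝ) - 1) - (∑ h, y h - y g) := by
      rw [Finset.sum_sub_distrib, Finset.sum_const, Finset.card_erase_of_mem (Finset.mem_univ _),
        Finset.sum_erase_eq_sub (Finset.mem_univ _)]
      simp [Nat.cast_sub (by omega : 1 ≤ n)]
    have h3 : (∑ j ∈ Finset.univ.erase g, (1 - y j)) / ((n : ℝ) - 1) ≤
        Real.exp (-((∑ h, y h - y g) / ((n : ℝ) - 1))) := by
      rw [h2, sub_div, div_self hn1.ne']
      exact Real.one_sub_le_exp_neg _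
    have h4 : 0 ≤ (∑ j ∈ Finset.univ.erase g, (1 - y j)) / ((n : ℝ) - 1) :=
      div_nonneg (Finset.sum_nonneg fun _ _ => hw _) hn1.le
    refine (pow_le_pow_left₀ h4 h3 _).trans (le_of_eq ?_)
    rw [← Real.exp_nat_mul]
    congr 1
    ring
  have hGnn : ∀ d, 0 ≤ ∑ σ, G d σ := by
    intro d
    refine Finset.sum_nonneg fun σ _ => ?_
    rw [hG]
    simp only
    split_ifs
    · exact Finset.prod_nonneg fun _ _ => hw _
    · exact le_rfl
  rw [hsum, huniv, Finset.prod_insert (notMem_map_of_forall_ne h₀), Finset.prod_map]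
  calc (∑ σ, G d₀ σ) * ∏ g, ∑ σ, G (f g) σ ≤ (n.factorial * ∏ h, Real.exp (-y h)) *
        ∏ g, ((n - 1).factorial * Real.exp (-((∑ h, y h - y g) / ((n : ℝ) - 1) * a g))) := by
        refine mul_le_mul hG₀ (Finset.prod_le_prod (fun _ _ => hGnn _) fun g _ => hGf g)
          (Finset.prod_nonneg fun _ _ => hGnn _) (by positivity)
    _ = _ := by
        rw [Finset.prod_mul_distrib, Finset.prod_const, Finset.card_univ, Fintype.card_fin,
          ← Real.exp_sum, ← Real.exp_sum, ← Real.exp_sum]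
        have : ∑ h, -(y h * (1 + (∑ i, (a i : ℝ) - a h) / ((n : ℝ) - 1))) =
            ∑ h, -y h + ∑ g, -((∑ h, y h - y g) / ((n : ℝ) - 1) * a g) := by
          have h1 : ∀ h, -(y h * (1 + (∑ i, (a i : ℝ) - a h) / ((n : ℝ) - 1))) =
              -y h + -((y h * ∑ i, (a i : ℝ)) / ((n : ℝ) - 1) - y h * a h / ((n : ℝ) - 1)) := by
            intro h; ring
          have h2 : ∀ g, -((∑ h, y h - y g) / ((n : ℝ) - 1) * a g) =
              -(((∑ h, y h) * a g) / ((n : ℝ) - 1) - y g * a g / ((n : ℝ) - 1)) := by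
            intro g; ring
          simp only [h1, h2]
          have h3 : ∑ h, (y h * ∑ i, (a i : ℝ)) / ((n : ℝ) - 1) =
              ∑ g, ((∑ h, y h) * a g) / ((n : ℝ) - 1) := by
            rw [← Finset.sum_div, ← Finset.sum_div, ← Finset.sum_mul, ← Finset.mul_sum]
          rw [Finset.sum_add_distrib, Finset.sum_neg_distrib (G := ℝ) (fun h => y h),
            Finset.sum_neg_distrib, Finset.sum_neg_distrib, Finset.sum_sub_distrib,
            Finset.sum_sub_distrib, h3]
        rw [this, Real.exp_add]
        ring

open Equiv in
/-- The integrated form of `sum_prod_pow_suitors_le`. Lebesgue measure on `[0, 1]` turns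
`(1 - y) ^ k` into `1 / (k + 1)`, and a Dirac measure into an exponential penalty. -/
theorem sum_prod_integral_suitors_le {n : ℕ} (hn : 2 ≤ n) (f : Fin n ↪ Fin (n + 1))
    (a : Fin n → Fin n) (ν : Fin n → Measure ℝ) [∀ h, IsFiniteMeasure (ν h)]
    (hν : ∀ h, ∀ᵐ y ∂ν h, y ∈ Set.Icc (0 : ℝ) 1) :
    ∑ p : Fin (n + 1) → Perm (Fin n) with ∀ h, p (f h) h = a h,
        ∏ h, ∫ y, (1 - y) ^ (suitors p f h).card ∂ν h ≤
      (n.factorial : ℝ) * ((n - 1).factorial : ℝ) ^ n *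
        ∏ h, ∫ y, Real.exp (-(y * (1 + (∑ i, (a i : ℝ) - a h) / ((n : ℝ) - 1)))) ∂ν h := by
  have hint : ∀ (h : Fin n) (g : ℝ → ℝ), Continuous g → Integrable g (ν h) := by
    intro h g hg
    obtain ⟨C, hC⟩ := (isCompact_Icc (a := (0 : ℝ)) (b := 1)).exists_bound_of_continuousOn
      hg.continuousOn
    exact Integrable.of_bound hg.aestronglyMeasurable C ((hν h).mono fun y hy => hC y hy)
  have hae : ∀ᵐ y ∂Measure.pi ν, ∀ h, y h ∈ Set.Icc (0 : ℝ) 1 :=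
    ae_all_iff.mpr fun h => Measure.tendsto_eval_ae_ae.eventually (hν h)
  simp only [← integral_fintype_prod_eq_prod
    (fun h y => Real.exp (-(y * (1 + (∑ i, (a i : ℝ) - a h) / ((n : ℝ) - 1)))))]
  have hL : ∀ p : Fin (n + 1) → Perm (Fin n),
      ∏ h, ∫ y, (1 - y) ^ (suitors p f h).card ∂ν h =
        ∫ y, ∏ h, (1 - y h) ^ (suitors p f h).card ∂Measure.pi ν := fun p =>
    (integral_fintype_prod_eq_prod (fun h y => (1 - y) ^ (suitors p f h).card)).symm
  have hLi : ∀ p : Fin (n + 1) → Perm (Fin n),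
      Integrable (fun y : Fin n → ℝ => ∏ h, (1 - y h) ^ (suitors p f h).card) (Measure.pi ν) :=
    fun p => Integrable.fintype_prod (f := fun h y => (1 - y) ^ (suitors p f h).card)
      fun h => hint h _ (by fun_prop)
  simp only [hL]
  rw [← integral_finsetSum _ fun p _ => hLi p, ← integral_const_mul]
  refine integral_mono_ae (integrable_finsetSum _ fun p _ => hLi p) ?_ ?_
  · exact (Integrable.fintype_prod
      (f := fun h y => Real.exp (-(y * (1 + (∑ i, (a i : ℝ) - a h) / ((n : ℝ) - 1)))))
      fun h => hint h _ (by fun_prop)).const_mul _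
  · exact hae.mono fun y hy => sum_prod_pow_suitors_le hn f a y hy

theorem integral_one_sub_pow (k : ℕ) :
    ∫ y in Set.Icc (0 : ℝ) 1, (1 - y) ^ k = 1 / ((k : ℝ) + 1) := by
  rw [integral_Icc_eq_integral_Ioc, ← intervalIntegral.integral_of_le zero_le_one,
    intervalIntegral.integral_comp_sub_left (fun y => y ^ k)]
  simp

theorem integral_exp_neg_mul_le {c : ℝ} (hc : 0 < c) :
    ∫ y in Set.Icc (0 : ℝ) 1, Real.exp (-(y * c)) ≤ 1 / c := by
  have h1 : ∀ y : ℝ, -(y * c) = (-c) * y := fun y => by ring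
  simp only [h1]
  rw [integral_Icc_eq_integral_Ioc, ← intervalIntegral.integral_of_le zero_le_one,
    intervalIntegral.integral_comp_mul_left Real.exp (neg_ne_zero.mpr hc.ne'), integral_exp]
  simp only [mul_zero, mul_one, Real.exp_zero, smul_eq_mul]
  rw [inv_neg, neg_mul, ← mul_neg, neg_sub, one_div]
  have := Real.exp_pos (-c)
  exact mul_le_of_le_one_right (by positivity) (by linarith)

/-- The vectors of places, counted from `0`, with sum `S`. -/
def placeVectors (n S : ℕ) : Finset (Fin n → Fin n) :=
  Finset.univ.filter fun a => ∑ h, (a h : ℕ) = S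

theorem sum_placeVectors_cast {n S : ℕ} {a : Fin n → Fin n} (ha : a ∈ placeVectors n S) :
    ∑ h, (a h : ℝ) = S := by
  simp only [placeVectors, Finset.mem_filter, Finset.mem_univ, true_and] at ha
  exact_mod_cast congrArg (Nat.cast (R := ℝ)) ha

theorem le_of_mem_placeVectors {n S : ℕ} {a : Fin n → Fin n} (ha : a ∈ placeVectors n S)
    (h : Fin n) : (a h : ℝ) ≤ S := by
  rw [← sum_placeVectors_cast ha]
  exact Finset.single_le_sum (f := fun h => (a h : ℝ)) (fun _ _ => by positivity)
    (Finset.mem_univ h)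

/-- The factors on the left are smallest on average when the places are as unequal as possible,
which costs no more than the constant `e`. -/
theorem prod_div_add_sub_le {n S : ℕ} (hn : 2 ≤ n) {a : Fin n → Fin n}
    (ha : a ∈ placeVectors n S) :
    ∏ h, (((n : ℝ) - 1) / ((n : ℝ) - 1 + (S - a h))) ≤
      Real.exp 1 * (((n : ℝ) - 1) / (S + ((n : ℝ) - 1))) ^ n := by
  have hn1 : (0 : ℝ) < (n : ℝ) - 1 := by
    have : (2 : ℝ) ≤ n := by exact_mod_cast hn
    linarith
  have hSn : (0 : ℝ) < S + ((n : ℝ) - 1) := by positivity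
  have hfac : ∀ h, ((n : ℝ) - 1) / ((n : ℝ) - 1 + (S - a h)) ≤
      Real.exp (a h / S) * (((n : ℝ) - 1) / (S + ((n : ℝ) - 1))) := by
    intro h
    have haS := le_of_mem_placeVectors ha h
    have han : (a h : ℝ) ≤ (n : ℝ) - 1 := by
      have : (a h : ℕ) + 1 ≤ n := (a h).isLt
      have : ((a h : ℕ) : ℝ) + 1 ≤ n := by exact_mod_cast this
      linarith
    have hden : (0 : ℝ) < (n : ℝ) - 1 + (S - a h) := by linarith
    have ha0 : (0 : ℝ) ≤ a h := by positivity
    rw [div_eq_mul_one_div, mul_comm, mul_div_assoc', mul_comm (Real.exp _), mul_div_assoc,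
      mul_comm, mul_le_mul_iff_right₀ hn1, div_le_div_iff₀ hden hSn, one_mul]
    rcases ha0.eq_or_lt with h0 | h0
    · rw [← h0]; simp; linarith
    · have hS : (0 : ℝ) < S := h0.trans_le haS
      have h1 := Real.add_one_le_exp ((a h : ℝ) / S)
      have h2 : S + ((n : ℝ) - 1) ≤ (a h / S + 1) * ((n : ℝ) - 1 + (S - a h)) := by
        rw [add_mul, one_mul, div_mul_eq_mul_div]
        have : (a h : ℝ) ≤ a h * ((n : ℝ) - 1 + (S - a h)) / S := by
          rw [le_div_iff₀ hS]
          exact mul_le_mul_of_nonneg_left (by linarith) ha0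
        linarith
      exact h2.trans (mul_le_mul_of_nonneg_right h1 hden.le)
  have hden : ∀ h, (0 : ℝ) ≤ ((n : ℝ) - 1) / ((n : ℝ) - 1 + (S - a h)) := fun h =>
    div_nonneg hn1.le (by linarith [le_of_mem_placeVectors ha h])
  refine (Finset.prod_le_prod (fun h _ => hden h) fun h _ => hfac h).trans ?_
  rw [Finset.prod_mul_distrib, Finset.prod_const, Finset.card_univ, Fintype.card_fin,
    ← Real.exp_sum, ← Finset.sum_div, sum_placeVectors_cast ha]
  gcongr
  exact div_self_le_one _

/-- The bound for the total weight, over the preferences of the doctors with place sum `S`, of the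
conditional probability that a fixed assignment is stable. -/
noncomputable def weightBound (n S : ℕ) : ℝ :=
  (n.factorial : ℝ) * ((n - 1).factorial : ℝ) ^ n * (placeVectors n S).card *
    (Real.exp 1 * (((n : ℝ) - 1) / (S + ((n : ℝ) - 1))) ^ n)

open Equiv in
theorem sum_placeSum_le {n S : ℕ} (f : Fin n ↪ Fin (n + 1))
    (g : (Fin (n + 1) → Perm (Fin n)) → ℝ) (B : ℝ)
    (hB : ∀ a ∈ placeVectors n S,
      ∑ p : Fin (n + 1) → Perm (Fin n) with ∀ h, p (f h) h = a h, g p ≤ B) :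
    ∑ p : Fin (n + 1) → Perm (Fin n) with placeSum p f = S, g p ≤
      (placeVectors n S).card * B := by
  rw [← Finset.sum_fiberwise_of_maps_to (t := placeVectors n S)
    (g := fun p h => p (f h) h) (fun p hp => by
      simp only [placeVectors, Finset.mem_filter, Finset.mem_univ, true_and]
      exact (Finset.mem_filter.mp hp).2)]
  rw [← nsmul_eq_mul]
  refine Finset.sum_le_card_nsmul _ _ _ fun a ha => ?_
  refine le_trans (le_of_eq ?_) (hB a ha)
  refine Finset.sum_congr ?_ fun _ _ => rfl
  ext p
  simp only [placeVectors, Finset.mem_filter, Finset.mem_univ, true_and] at ha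
  rw [Finset.mem_filter, Finset.mem_filter, Finset.mem_filter]
  simp only [Finset.mem_univ, true_and, funext_iff]
  exact ⟨fun h => h.2, fun h => ⟨by simpa [placeSum, h] using ha, h⟩⟩

open Equiv in
theorem sum_prod_suitors_le_weightBound {n : ℕ} (hn : 2 ≤ n) (S : ℕ) (f : Fin n ↪ Fin (n + 1)) :
    ∑ p : Fin (n + 1) → Perm (Fin n) with placeSum p f = S,
        ∏ h, 1 / (((suitors p f h).card : ℝ) + 1) ≤ weightBound n S := by
  have hn1 : (0 : ℝ) < (n : ℝ) - 1 := by
    have : (2 : ℝ) ≤ n := by exact_mod_cast hn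
    linarith
  refine (sum_placeSum_le f _ ((n.factorial : ℝ) * ((n - 1).factorial : ℝ) ^ n *
    (Real.exp 1 * (((n : ℝ) - 1) / (S + ((n : ℝ) - 1))) ^ n)) fun a ha => ?_).trans
    (le_of_eq (by rw [weightBound]; ring))
  have h1 := sum_prod_integral_suitors_le hn f a
    (fun _ => volume.restrict (Set.Icc (0 : ℝ) 1)) fun h => ae_restrict_mem measurableSet_Icc
  simp only [integral_one_sub_pow, sum_placeVectors_cast ha] at h1
  refine h1.trans ?_
  refine mul_le_mul_of_nonneg_left (le_trans ?_ (prod_div_add_sub_le hn ha)) (by positivity)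
  refine Finset.prod_le_prod (fun h _ => integral_nonneg fun y => (Real.exp_pos _).le) fun h _ => ?_
  have haS := le_of_mem_placeVectors ha h
  have hc : 0 < 1 + ((S : ℝ) - a h) / ((n : ℝ) - 1) :=
    add_pos_of_pos_of_nonneg one_pos (div_nonneg (by linarith) hn1.le)
  refine (integral_exp_neg_mul_le hc).trans (le_of_eq ?_)
  have : (0 : ℝ) < (n : ℝ) - 1 + (S - a h) := by linarith
  field_simp

open Equiv in
/-- Few suitors at a hospital `j` are exponentially unlikely, even after weighting with the
conditional probability of stability. -/
theorem sum_prod_suitors_few_le {n : ℕ} (hn : 2 ≤ n) (S : ℕ) (f : Fin n ↪ Fin (n + 1))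
    (j : Fin n) (κ : ℝ) :
    ∑ p : Fin (n + 1) → Perm (Fin n) with placeSum p f = S,
        (if ((suitors p f j).card : ℝ) ≤ κ then
          ∏ h, 1 / (((suitors p f h).card : ℝ) + 1) else 0) ≤
      (2 ^ κ * Real.exp (-(S / (2 * n))) * (n + 1)) * weightBound n S := by
  have hn2 : (2 : ℝ) ≤ n := by exact_mod_cast hn
  have hn1 : (0 : ℝ) < (n : ℝ) - 1 := by linarith
  refine (sum_placeSum_le f _ (2 ^ κ * ((n.factorial : ℝ) * ((n - 1).factorial : ℝ) ^ n *
    ((Real.exp (-(S / (2 * n))) * (n + 1)) *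
      (Real.exp 1 * (((n : ℝ) - 1) / (S + ((n : ℝ) - 1))) ^ n)))) fun a ha => ?_).trans
    (le_of_eq (by rw [weightBound]; ring))
  set ν : Fin n → Measure ℝ := fun h =>
    if h = j then Measure.dirac (1 / 2) else volume.restrict (Set.Icc (0 : ℝ) 1) with hν
  have hfin : ∀ h, IsFiniteMeasure (ν h) := by
    intro h; simp only [hν]; split_ifs <;> infer_instance
  have hae : ∀ h, ∀ᵐ y ∂ν h, y ∈ Set.Icc (0 : ℝ) 1 := by
    intro h
    simp only [hν]
    split_ifs
    · exact (ae_dirac_iff measurableSet_Icc).mpr (by norm_num)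
    · exact ae_restrict_mem measurableSet_Icc
  have h1 := sum_prod_integral_suitors_le hn f a ν hae
  have hνj : ν j = Measure.dirac (1 / 2) := by simp [hν]
  have hνh : ∀ h ∈ Finset.univ.erase j, ν h = volume.restrict (Set.Icc (0 : ℝ) 1) := by
    intro h hh; simp [hν, Finset.ne_of_mem_erase hh]
  have hL : ∀ p : Fin (n + 1) → Perm (Fin n),
      (if ((suitors p f j).card : ℝ) ≤ κ then
          ∏ h, 1 / (((suitors p f h).card : ℝ) + 1) else 0) ≤
        2 ^ κ * ∏ h, ∫ y, (1 - y) ^ (suitors p f h).card ∂ν h := by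
    intro p
    have hrest : ∏ h ∈ Finset.univ.erase j, ∫ y, (1 - y) ^ (suitors p f h).card ∂ν h =
        ∏ h ∈ Finset.univ.erase j, 1 / (((suitors p f h).card : ℝ) + 1) :=
      Finset.prod_congr rfl fun h hh => by rw [hνh h hh, integral_one_sub_pow]
    rw [← Finset.mul_prod_erase _ _ (Finset.mem_univ j), ← Finset.mul_prod_erase _ _
      (Finset.mem_univ j), hrest, hνj, integral_dirac, ← mul_assoc]
    split_ifs with hk
    · refine mul_le_mul_of_nonneg_right ?_ (Finset.prod_nonneg fun _ _ => by positivity)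
      have h2 : 1 / (((suitors p f j).card : ℝ) + 1) ≤ 1 := by
        rw [div_le_one (by positivity)]; linarith [Nat.cast_nonneg (α := ℝ) (suitors p f j).card]
      refine h2.trans ?_
      have h3 : (1 - 1 / 2 : ℝ) ^ (suitors p f j).card = 2 ^ (-((suitors p f j).card : ℝ)) := by
        rw [Real.rpow_neg (by norm_num), Real.rpow_natCast, ← inv_pow]; norm_num
      rw [h3, ← Real.rpow_add (by norm_num)]
      exact Real.one_le_rpow (by norm_num) (by linarith)
    · refine mul_nonneg (mul_nonneg (by positivity) (by norm_num)) ?_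
      exact Finset.prod_nonneg fun _ _ => by positivity
  refine (Finset.sum_le_sum fun p _ => hL p).trans ?_
  rw [← Finset.mul_sum]
  refine mul_le_mul_of_nonneg_left (h1.trans ?_) (by positivity)
  refine mul_le_mul_of_nonneg_left ?_ (by positivity)
  refine le_trans ?_ (mul_le_mul_of_nonneg_left (prod_div_add_sub_le hn ha) (by positivity))
  rw [← Finset.mul_prod_erase _ _ (Finset.mem_univ j), ← Finset.mul_prod_erase _ _
    (Finset.mem_univ j), hνj, integral_dirac, sum_placeVectors_cast ha, ← mul_assoc]
  have hden : ∀ h, (0 : ℝ) < (n : ℝ) - 1 + (S - a h) := fun h => by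
    linarith [le_of_mem_placeVectors ha h]
  have haj : (a j : ℝ) ≤ (n : ℝ) - 1 := by
    have : ((a j : ℕ) : ℝ) + 1 ≤ n := by exact_mod_cast (a j).isLt
    linarith
  refine mul_le_mul ?_ ?_ ?_ ?_
  · rw [mul_assoc]
    have hS : (S : ℝ) ≤ n * ((n : ℝ) - 1) := by
      rw [← sum_placeVectors_cast ha]
      refine (Finset.sum_le_card_nsmul _ _ ((n : ℝ) - 1) fun h _ => ?_).trans (by simp)
      have : ((a h : ℕ) : ℝ) + 1 ≤ n := by exact_mod_cast (a h).isLt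
      linarith
    have h2 : 1 ≤ ((n : ℝ) + 1) * (((n : ℝ) - 1) / ((n : ℝ) - 1 + (S - a j))) := by
      rw [mul_div_assoc', le_div_iff₀ (hden j)]
      have : (0 : ℝ) ≤ a j := by positivity
      nlinarith
    refine le_trans ?_ (le_mul_of_one_le_right (Real.exp_pos _).le h2)
    refine Real.exp_le_exp.mpr (neg_le_neg ?_)
    have h3 : (S : ℝ) / n ≤ 1 + (S - a j) / ((n : ℝ) - 1) := by
      have : (1 : ℝ) + (S - a j) / ((n : ℝ) - 1) = ((n : ℝ) - 1 + (S - a j)) / ((n : ℝ) - 1) := by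
        field_simp
      rw [this]
      have : (0 : ℝ) ≤ S := by positivity
      exact div_le_div₀ (hden j).le (by linarith) hn1 (by linarith)
    calc (S : ℝ) / (2 * n) = 1 / 2 * (S / n) := by field_simp
      _ ≤ _ := mul_le_mul_of_nonneg_left h3 (by norm_num)
  · refine Finset.prod_le_prod (fun h _ => integral_nonneg fun y => (Real.exp_pos _).le)
      fun h hh => ?_
    rw [hνh h hh]
    have hc : 0 < 1 + ((S : ℝ) - a h) / ((n : ℝ) - 1) :=
      add_pos_of_pos_of_nonneg one_pos
        (div_nonneg (by linarith [le_of_mem_placeVectors ha h]) hn1.le)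
    refine (integral_exp_neg_mul_le hc).trans (le_of_eq ?_)
    have := hden h
    field_simp
  · exact Finset.prod_nonneg fun h _ => integral_nonneg fun y => (Real.exp_pos _).le
  · exact mul_nonneg (by positivity) (div_nonneg hn1.le (hden j).le)

/-! ### The expected number of stable matchings with a given place sum -/

theorem factorial_mul_exp_le {n : ℕ} (hn : 1 ≤ n) :
    (n.factorial : ℝ) * Real.exp n ≤ Real.exp 1 * n * (n : ℝ) ^ n := by
  induction n, hn using Nat.le_induction with
  | base => simp
  | succ n hn ih =>
    have hn0 : (0 : ℝ) < n := by exact_mod_cast hn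
    have hlog : 1 ≤ ((n : ℝ) + 1) * Real.log ((n + 1) / n) := by
      have h1 := Real.one_sub_inv_le_log_of_pos (x := ((n : ℝ) + 1) / n) (by positivity)
      have h2 : 1 - (((n : ℝ) + 1) / n)⁻¹ = 1 / (n + 1) := by field_simp; ring
      rw [h2, div_le_iff₀ (by positivity)] at h1
      linarith
    have hpow : Real.exp 1 * (n : ℝ) ^ (n + 1) ≤ ((n : ℝ) + 1) ^ (n + 1) := by
      have h3 : Real.exp 1 ≤ (((n : ℝ) + 1) / n) ^ (n + 1) := by
        rw [← Real.exp_log (show (0 : ℝ) < (n + 1) / n by positivity), ← Real.exp_nat_mul]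
        refine Real.exp_le_exp.mpr ?_
        push_cast
        exact hlog
      rwa [div_pow, le_div_iff₀ (by positivity)] at h3
    push_cast [Nat.factorial_succ]
    rw [Real.exp_add]
    calc ((n : ℝ) + 1) * n.factorial * (Real.exp n * Real.exp 1)
        = (n + 1) * Real.exp 1 * (n.factorial * Real.exp n) := by ring
      _ ≤ (n + 1) * Real.exp 1 * (Real.exp 1 * n * (n : ℝ) ^ n) := by gcongr
      _ = Real.exp 1 * (n + 1) * (Real.exp 1 * (n : ℝ) ^ (n + 1)) := by ring
      _ ≤ Real.exp 1 * (n + 1) * ((n : ℝ) + 1) ^ (n + 1) := by gcongr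

theorem exp_le_div_add_pow {n S : ℕ} (hn : 1 ≤ n) :
    Real.exp (-((n : ℝ) - n ^ 2 / (2 * (S + n)))) ≤ ((S : ℝ) / (S + n)) ^ S := by
  have hn0 : (0 : ℝ) < n := by exact_mod_cast hn
  rcases Nat.eq_zero_or_pos S with rfl | hS
  · simp only [CharP.cast_eq_zero, zero_add, pow_zero, Real.exp_le_one_iff, Left.neg_nonpos_iff,
      sub_nonneg]
    rw [div_le_iff₀ (by positivity)]
    nlinarith
  have hS0 : (0 : ℝ) < S := by exact_mod_cast hS
  set x : ℝ := (S + n) / S with hx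
  have hx0 : 0 < x := by positivity
  have hx1 : 1 ≤ x := by rw [hx, le_div_iff₀ hS0]; linarith
  have hlog : Real.log x ≤ (x - x⁻¹) / 2 := by
    have := Real.self_le_sinh_iff.mpr (Real.log_nonneg hx1)
    rwa [Real.sinh_log hx0] at this
  have h1 : (S : ℝ) / (S + n) = Real.exp (-Real.log x) := by
    rw [Real.exp_neg, Real.exp_log hx0, hx, inv_div]
  rw [h1, ← Real.exp_nat_mul]
  refine Real.exp_le_exp.mpr ?_
  rw [mul_neg, neg_le_neg_iff]
  refine (mul_le_mul_of_nonneg_left hlog hS0.le).trans (le_of_eq ?_)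
  rw [hx]
  field_simp
  ring

/-- Chernoff's bound for the number of place vectors, with the geometric weight `S / (S + n)`.
The last factor accounts for the places being bounded by `n`. -/
theorem card_placeVectors_le {n : ℕ} (hn : 1 ≤ n) (S : ℕ) :
    ((placeVectors n S).card : ℝ) ≤ (1 - ((S : ℝ) / (S + n)) ^ n) ^ n *
      (((S : ℝ) + n) / n) ^ n * Real.exp ((n : ℝ) - n ^ 2 / (2 * (S + n))) := by
  have hn0 : (0 : ℝ) < n := by exact_mod_cast hn
  set r : ℝ := S / (S + n) with hr
  have hr0 : 0 ≤ r := by positivity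
  have hr1 : 1 - r = n / (S + n) := by rw [hr]; field_simp; ring
  have hr1' : 0 < 1 - r := by rw [hr1]; positivity
  have h1 : ((placeVectors n S).card : ℝ) * r ^ S ≤ ((1 - r ^ n) / (1 - r)) ^ n := by
    calc ((placeVectors n S).card : ℝ) * r ^ S
        = ∑ a ∈ placeVectors n S, ∏ h, r ^ (a h : ℕ) := by
          rw [← nsmul_eq_mul, ← Finset.sum_const]
          refine Finset.sum_congr rfl fun a ha => ?_
          rw [Finset.prod_pow_eq_pow_sum]
          congr 1
          exact (Finset.mem_filter.mp ha).2.symm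
      _ ≤ ∑ a : Fin n → Fin n, ∏ h, r ^ (a h : ℕ) :=
          Finset.sum_le_univ_sum_of_nonneg fun a => by positivity
      _ = ∏ _h : Fin n, ∑ b : Fin n, r ^ (b : ℕ) := by
          rw [Finset.prod_univ_sum, Fintype.piFinset_univ]
      _ = ((1 - r ^ n) / (1 - r)) ^ n := by
          rw [Finset.prod_const, Finset.card_univ, Fintype.card_fin,
            Fin.sum_univ_eq_sum_range fun b => r ^ b, geom_sum_eq (by linarith),
            ← neg_div_neg_eq, neg_sub, neg_sub]
  have h2 := exp_le_div_add_pow (S := S) hn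
  have h3 : ((placeVectors n S).card : ℝ) * Real.exp (-((n : ℝ) - n ^ 2 / (2 * (S + n)))) ≤
      ((1 - r ^ n) / (1 - r)) ^ n :=
    (mul_le_mul_of_nonneg_left h2 (by positivity)).trans h1
  rw [Real.exp_neg, mul_inv_le_iff₀ (Real.exp_pos _)] at h3
  refine h3.trans (le_of_eq ?_)
  rw [hr1, ← mul_pow, div_div_eq_mul_div, mul_div_assoc]

/-- The bound for the expected number of stable matchings with place sum `S`: there are `(n + 1)!`
assignments, and `n !` lists for each doctor. -/
noncomputable def expectedBound (n S : ℕ) : ℝ :=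
  ((n + 1).factorial : ℝ) * (weightBound n S / (n.factorial : ℝ) ^ (n + 1))

theorem weightBound_nonneg {n : ℕ} (hn : 2 ≤ n) (S : ℕ) : 0 ≤ weightBound n S := by
  have hn2 : (2 : ℝ) ≤ n := by exact_mod_cast hn
  have : (0 : ℝ) ≤ (n : ℝ) - 1 := by linarith
  unfold weightBound
  positivity

theorem expectedBound_nonneg {n : ℕ} (hn : 2 ≤ n) (S : ℕ) : 0 ≤ expectedBound n S := by
  have := weightBound_nonneg hn S
  unfold expectedBound
  positivity

theorem expectedBound_le {n : ℕ} (hn : 2 ≤ n) (S : ℕ) :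
    expectedBound n S ≤ Real.exp 2 * (n * (n + 1)) *
      (Real.exp (-((n : ℝ) ^ 2 / (2 * (S + n)))) * (1 - ((S : ℝ) / (S + n)) ^ n) ^ n) := by
  have hn2 : (2 : ℝ) ≤ n := by exact_mod_cast hn
  have hn0 : (0 : ℝ) < n := by linarith
  have hn1 : (0 : ℝ) < (n : ℝ) - 1 := by linarith
  have hSn : (0 : ℝ) < S + ((n : ℝ) - 1) := by positivity
  have hfact : (n.factorial : ℝ) = n * ((n - 1).factorial : ℝ) := by
    exact_mod_cast (Nat.mul_factorial_pred (by omega : n ≠ 0)).symm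
  have hf1 : (0 : ℝ) < ((n - 1).factorial : ℝ) := by positivity
  have h1 : expectedBound n S = ((n + 1) * Real.exp 1) * (n.factorial / (n : ℝ) ^ n) *
      ((placeVectors n S).card * (((n : ℝ) - 1) / (S + ((n : ℝ) - 1))) ^ n) := by
    rw [expectedBound, weightBound, Nat.factorial_succ, pow_succ]
    push_cast
    have h2 : (n.factorial : ℝ) ^ n = (n : ℝ) ^ n * ((n - 1).factorial : ℝ) ^ n := by
      rw [hfact, mul_pow]
    rw [h2]
    have : (0 : ℝ) < (n.factorial : ℝ) := by positivity
    field_simp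
  have hr : (S : ℝ) / (S + n) ≤ 1 := by rw [div_le_one (by positivity)]; linarith
  have hr' : 0 ≤ 1 - ((S : ℝ) / (S + n)) ^ n := by
    linarith [pow_le_one₀ (by positivity : (0 : ℝ) ≤ S / (S + n)) hr (n := n)]
  have h2 : (((S : ℝ) + n) / n) ^ n * (((n : ℝ) - 1) / (S + ((n : ℝ) - 1))) ^ n ≤ 1 := by
    rw [← mul_pow]
    refine pow_le_one₀ (by positivity) ?_
    rw [div_mul_div_comm, div_le_one (by positivity)]
    nlinarith [(Nat.cast_nonneg S : (0 : ℝ) ≤ S)]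
  have h3 : (n.factorial : ℝ) / (n : ℝ) ^ n * Real.exp n ≤ Real.exp 1 * n := by
    rw [div_mul_eq_mul_div, div_le_iff₀ (by positivity)]
    exact factorial_mul_exp_le (by omega)
  rw [h1]
  calc _ ≤ ((n + 1) * Real.exp 1) * (n.factorial / (n : ℝ) ^ n) *
        (((1 - ((S : ℝ) / (S + n)) ^ n) ^ n * (((S : ℝ) + n) / n) ^ n *
          Real.exp ((n : ℝ) - n ^ 2 / (2 * (S + n)))) *
            (((n : ℝ) - 1) / (S + ((n : ℝ) - 1))) ^ n) := by
        gcongr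
        exact card_placeVectors_le (by omega) S
    _ = ((n + 1) * Real.exp 1) * (n.factorial / (n : ℝ) ^ n * Real.exp n) *
        ((Real.exp (-((n : ℝ) ^ 2 / (2 * (S + n)))) * (1 - ((S : ℝ) / (S + n)) ^ n) ^ n) *
        ((((S : ℝ) + n) / n) ^ n * (((n : ℝ) - 1) / (S + ((n : ℝ) - 1))) ^ n)) := by
        rw [sub_eq_add_neg (n : ℝ) ((n : ℝ) ^ 2 / (2 * (S + n))), Real.exp_add]
        ring
    _ ≤ ((n + 1) * Real.exp 1) * (Real.exp 1 * n) *
        ((Real.exp (-((n : ℝ) ^ 2 / (2 * (S + n)))) * (1 - ((S : ℝ) / (S + n)) ^ n) ^ n) * 1) := by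
        gcongr
    _ = _ := by
        rw [show Real.exp 2 = Real.exp 1 * Real.exp 1 by rw [← Real.exp_add]; norm_num]
        ring

/-- Small place sums are unlikely. -/
theorem expectedBound_le_exp {n : ℕ} (hn : 2 ≤ n) (S : ℕ) :
    expectedBound n S ≤
      Real.exp 2 * (n * (n + 1)) * Real.exp (-((n : ℝ) ^ 2 / (2 * (S + n)))) := by
  refine (expectedBound_le hn S).trans ?_
  have hn0 : (0 : ℝ) < n := by exact_mod_cast (by omega : 0 < n)
  have hr : (S : ℝ) / (S + n) ≤ 1 := by rw [div_le_one (by positivity)]; linarith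
  have hr0 : (0 : ℝ) ≤ S / (S + n) := by positivity
  have h1 : (1 - ((S : ℝ) / (S + n)) ^ n) ^ n ≤ 1 :=
    pow_le_one₀ (by linarith [pow_le_one₀ hr0 hr (n := n)]) (by linarith [pow_nonneg hr0 n])
  have := (Real.exp_pos (-((n : ℝ) ^ 2 / (2 * (S + n))))).le
  exact mul_le_mul_of_nonneg_left (mul_le_of_le_one_right this h1) (by positivity)

/-- Large place sums are unlikely. -/
theorem expectedBound_le_exp_exp {n : ℕ} (hn : 2 ≤ n) {S : ℕ} (hS : 1 ≤ S) :
    expectedBound n S ≤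
      Real.exp 2 * (n * (n + 1)) * Real.exp (-(n * Real.exp (-((n : ℝ) ^ 2 / S)))) := by
  refine (expectedBound_le hn S).trans ?_
  have hn0 : (0 : ℝ) < n := by exact_mod_cast (by omega : 0 < n)
  have hS0 : (0 : ℝ) < S := by exact_mod_cast hS
  have hr : (S : ℝ) / (S + n) ≤ 1 := by rw [div_le_one (by positivity)]; linarith
  have hr0 : (0 : ℝ) ≤ S / (S + n) := by positivity
  have h1 : Real.exp (-((n : ℝ) ^ 2 / S)) ≤ ((S : ℝ) / (S + n)) ^ n := by
    have h2 : Real.exp (-((n : ℝ) / S)) ≤ S / (S + n) := by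
      rw [Real.exp_neg, ← inv_div (S + n : ℝ) (S : ℝ)]
      gcongr
      have := Real.add_one_le_exp ((n : ℝ) / S)
      rw [add_div, div_self hS0.ne']
      linarith
    calc Real.exp (-((n : ℝ) ^ 2 / S)) = Real.exp (-((n : ℝ) / S)) ^ n := by
          rw [← Real.exp_nat_mul]; congr 1; ring
      _ ≤ _ := by gcongr
  have h2 : (1 - ((S : ℝ) / (S + n)) ^ n) ^ n ≤
      Real.exp (-(n * Real.exp (-((n : ℝ) ^ 2 / S)))) := by
    have h3 : 1 - ((S : ℝ) / (S + n)) ^ n ≤ Real.exp (-Real.exp (-((n : ℝ) ^ 2 / S))) :=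
      (by linarith : 1 - ((S : ℝ) / (S + n)) ^ n ≤ 1 - Real.exp (-((n : ℝ) ^ 2 / S))).trans
        (Real.one_sub_le_exp_neg _)
    refine (pow_le_pow_left₀ (by linarith [pow_le_one₀ hr0 hr (n := n)]) h3 n).trans (le_of_eq ?_)
    rw [← Real.exp_nat_mul]; congr 1; ring
  have h4 : Real.exp (-((n : ℝ) ^ 2 / (2 * (S + n)))) ≤ 1 := by
    rw [Real.exp_le_one_iff]
    have : (0 : ℝ) ≤ (n : ℝ) ^ 2 / (2 * (S + n)) := by positivity
    linarith
  refine mul_le_mul_of_nonneg_left ?_ (by positivity)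
  calc _ ≤ 1 * Real.exp (-(n * Real.exp (-((n : ℝ) ^ 2 / S)))) := by
        refine mul_le_mul h4 h2 ?_ zero_le_one
        exact pow_nonneg (by linarith [pow_le_one₀ hr0 hr (n := n)]) _
    _ = _ := one_mul _

/-! ### Averaging over the preferences of the hospitals -/

/-- Given the lists `p` of the doctors, the lists `q` of the hospitals make the assignment
`h ↦ f h` stable. -/
def StableAt {m n : ℕ} (p : Fin m → Equiv.Perm (Fin n)) (f : Fin n ↪ Fin m)
    (q : Fin n → Equiv.Perm (Fin m)) : Prop :=
  ∀ h, ∀ d ∈ suitors p f h, q h (f h) < q h d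

/-- The sum of the places, counted from `0`, that the hospitals give to their partners. -/
def hospSum {m n : ℕ} (q : Fin n → Equiv.Perm (Fin m)) (f : Fin n ↪ Fin m) : ℕ :=
  ∑ h, (q h (f h) : ℕ)

theorem Market.IsStable.stableAt {m n : ℕ} {P : Market m n} {f : Fin n ↪ Fin m}
    (hP : P.IsStable fun h => some (f h)) : StableAt P.1 f P.2 := by
  intro h d hd
  by_contra hlt
  refine hP.2 d h ⟨?_, ?_⟩
  · intro h' hh'
    simp only [suitors, Finset.mem_filter, Finset.mem_univ, true_and] at hd
    have := hd h' (Option.some.inj hh')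
    rw [Fin.lt_def] at this
    simpa [Market.docRank] using this
  · intro d' hd'
    have hd'' : f h = d' := Option.some.inj hd'
    subst hd''
    have hne : d ≠ f h := by rintro rfl; exact notMem_suitors_self _ _ _ hd
    have : P.2 h d < P.2 h (f h) :=
      lt_of_le_of_ne (not_lt.mp hlt) fun hc => hne ((P.2 h).injective hc)
    rw [Fin.lt_def] at this
    simpa [Market.hospRank] using this

open Classical Equiv in
theorem sum_stableAt_pow {n : ℕ} (p : Fin (n + 1) → Perm (Fin n)) (f : Fin n ↪ Fin (n + 1))
    (s : ℝ) :
    ∑ q : Fin n → Perm (Fin (n + 1)) with StableAt p f q, s ^ hospSum q f =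
      ∏ h, ∑ τ : Perm (Fin (n + 1)) with ∀ d ∈ suitors p f h, τ (f h) < τ d,
        s ^ (τ (f h) : ℕ) := by
  simp only [Finset.sum_filter]
  rw [Finset.prod_univ_sum, Fintype.piFinset_univ]
  refine Finset.sum_congr rfl fun q _ => ?_
  by_cases hq : StableAt p f q
  · rw [if_pos hq, hospSum, ← Finset.prod_pow_eq_pow_sum]
    exact Finset.prod_congr rfl fun h _ => (if_pos (hq h)).symm
  · rw [if_neg hq]
    simp only [StableAt, not_forall] at hq
    obtain ⟨h, hh⟩ := hq
    exact (Finset.prod_eq_zero (Finset.mem_univ h)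
      (if_neg (by simpa only [not_forall] using hh))).symm

open Classical Equiv in
theorem card_stableAt {n : ℕ} (p : Fin (n + 1) → Perm (Fin n)) (f : Fin n ↪ Fin (n + 1)) :
    ((Finset.univ.filter fun q : Fin n → Perm (Fin (n + 1)) => StableAt p f q).card : ℝ) =
      ((n + 1).factorial : ℝ) ^ n * ∏ h, 1 / (((suitors p f h).card : ℝ) + 1) := by
  have h1 := sum_stableAt_pow p f 1
  simp only [one_pow, Finset.sum_const, nsmul_eq_mul, mul_one] at h1
  rw [h1]
  have h2 : ∀ h, ((Finset.univ.filter fun τ : Perm (Fin (n + 1)) =>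
      ∀ d ∈ suitors p f h, τ (f h) < τ d).card : ℝ) =
        ((n + 1).factorial : ℝ) * (1 / (((suitors p f h).card : ℝ) + 1)) := by
    intro h
    rw [card_perm_lt_all _ _ (notMem_suitors_self p f h)]
    ring
  rw [Finset.prod_congr rfl fun h _ => h2 h, Finset.prod_mul_distrib]
  simp

/-- The inequality of arithmetic and geometric means. -/
theorem prod_le_pow_of_sum_le {ι : Type*} (s : Finset ι) (x : ι → ℝ) (hx : ∀ i ∈ s, 0 ≤ x i)
    {A : ℝ} (hA : 0 < A) (hsum : ∑ i ∈ s, x i ≤ s.card * A) : ∏ i ∈ s, x i ≤ A ^ s.card := by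
  have h1 : ∀ i ∈ s, x i ≤ A * Real.exp (x i / A - 1) := by
    intro i _
    have := Real.add_one_le_exp (x i / A - 1)
    rw [sub_add_cancel, div_le_iff₀ hA] at this
    linarith
  refine (Finset.prod_le_prod hx h1).trans ?_
  rw [Finset.prod_mul_distrib, Finset.prod_const, ← Real.exp_sum]
  refine mul_le_of_le_one_right (by positivity) (Real.exp_le_one_iff.mpr ?_)
  rw [Finset.sum_sub_distrib, ← Finset.sum_div, Finset.sum_const, nsmul_eq_mul, mul_one,
    sub_nonpos, div_le_iff₀ hA]
  exact hsum

open Classical Equiv in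
/-- A low average rank of the partners of the hospitals is exponentially unlikely under stability,
if the doctors are not too far down their lists. -/
theorem card_stableAt_hospSum_le {n : ℕ} (hn : 1 ≤ n) (p : Fin (n + 1) → Perm (Fin n))
    (f : Fin n ↪ Fin (n + 1)) {v B : ℝ} (hv : 0 < v) (hv1 : v ≤ 1) (hvB : v * B ≤ n)
    (hS : 16 * ((placeSum p f : ℝ) + 2 * n) ≤ n * ((n + 1) * v)) :
    ((Finset.univ.filter fun q : Fin n → Perm (Fin (n + 1)) =>
        StableAt p f q ∧ (hospSum q f : ℝ) ≤ B).card : ℝ) ≤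
      Real.exp (-n) * (((n + 1).factorial : ℝ) ^ n *
        ∏ h, 1 / (((suitors p f h).card : ℝ) + 1)) := by
  have hn0 : (0 : ℝ) < n := by exact_mod_cast hn
  -- Chernoff's bound at `-v`: the factor of `h` is at most `1 / (k + 1)` times
  -- `2 (k + 1) / ((n + 1) v)`, which is at most `1 / 8` on average over `h`.
  set s := Real.exp (-v) with hs
  have hs0 : 0 < s := Real.exp_pos _
  have hs1 : v / 2 ≤ 1 - s := by
    have h1 := Real.add_one_le_exp v
    have h2 : s ≤ 1 / (v + 1) := by
      rw [hs, Real.exp_neg, ← one_div]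
      exact one_div_le_one_div_of_le (by linarith) h1
    have h3 : 1 / (v + 1) ≤ 1 - v / 2 := by
      rw [div_le_iff₀ (by linarith)]; nlinarith
    linarith
  have hmarkov : ((Finset.univ.filter fun q : Fin n → Perm (Fin (n + 1)) =>
        StableAt p f q ∧ (hospSum q f : ℝ) ≤ B).card : ℝ) ≤ Real.exp (v * B) *
      ∑ q : Fin n → Perm (Fin (n + 1)) with StableAt p f q, s ^ hospSum q f := by
    rw [Finset.mul_sum, ← Finset.filter_filter, Finset.card_eq_sum_ones, Nat.cast_sum,
      Finset.sum_filter]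
    refine Finset.sum_le_sum fun q _ => ?_
    split_ifs with h
    · rw [hs, ← Real.exp_nat_mul, ← Real.exp_add, Nat.cast_one, Real.one_le_exp_iff]
      nlinarith
    · positivity
  have hfac : ∀ h, ∑ τ : Perm (Fin (n + 1)) with ∀ d ∈ suitors p f h, τ (f h) < τ d,
      s ^ (τ (f h) : ℕ) ≤ ((n + 1).factorial : ℝ) * (1 / (((suitors p f h).card : ℝ) + 1)) *
        (2 * (((suitors p f h).card : ℝ) + 1) / ((n + 1) * v)) := by
    intro h
    have hx : 1 - ((suitors p f h).card : ℝ) / n ≤ 1 := by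
      have : (0 : ℝ) ≤ ((suitors p f h).card : ℝ) / n := by positivity
      linarith
    have hsx : s * (1 - ((suitors p f h).card : ℝ) / n) ≤ s := mul_le_of_le_one_right hs0.le hx
    refine (sum_perm_lt_all_pow_le hn (f h) _ (notMem_suitors_self p f h) hs0.le
      (by linarith)).trans ?_
    calc (n.factorial : ℝ) / (1 - s * (1 - ((suitors p f h).card : ℝ) / n))
        ≤ n.factorial / (v / 2) := by gcongr; linarith
      _ = _ := by rw [Nat.factorial_succ]; push_cast; field_simp
  have hprod : ∏ h, (2 * (((suitors p f h).card : ℝ) + 1) / ((n + 1) * v)) ≤ (1 / 8 : ℝ) ^ n := by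
    have := prod_le_pow_of_sum_le (Finset.univ : Finset (Fin n))
      (fun h => 2 * (((suitors p f h).card : ℝ) + 1) / ((n + 1) * v))
      (fun h _ => by positivity) (A := 1 / 8) (by norm_num) (by
        rw [← Finset.sum_div, ← Finset.mul_sum, Finset.sum_add_distrib, ← Nat.cast_sum,
          sum_card_suitors, div_le_iff₀ (by positivity)]
        simp
        linarith)
    simpa using this
  have hexp : Real.exp (v * B) * (1 / 8 : ℝ) ^ n ≤ Real.exp (-n) := by
    have h1 : (1 / 8 : ℝ) ≤ Real.exp (-2) := by
      rw [Real.exp_neg, one_div]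
      refine inv_anti₀ (Real.exp_pos _) ?_
      have := Real.exp_one_lt_d9
      rw [show (2 : ℝ) = 1 + 1 by norm_num, Real.exp_add]
      nlinarith [Real.exp_pos 1]
    calc Real.exp (v * B) * (1 / 8 : ℝ) ^ n ≤ Real.exp n * Real.exp (-2) ^ n := by gcongr
      _ = Real.exp (-n) := by rw [← Real.exp_nat_mul, ← Real.exp_add]; congr 1; ring
  have hW : (0 : ℝ) ≤ ((n + 1).factorial : ℝ) ^ n *
      ∏ h, 1 / (((suitors p f h).card : ℝ) + 1) :=
    mul_nonneg (by positivity) (Finset.prod_nonneg fun _ _ => by positivity)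
  rw [sum_stableAt_pow] at hmarkov
  refine hmarkov.trans ?_
  calc _ ≤ Real.exp (v * B) * ∏ h, (((n + 1).factorial : ℝ) *
        (1 / (((suitors p f h).card : ℝ) + 1)) *
          (2 * (((suitors p f h).card : ℝ) + 1) / ((n + 1) * v))) := by
        refine mul_le_mul_of_nonneg_left ?_ (Real.exp_pos _).le
        exact Finset.prod_le_prod (fun h _ => Finset.sum_nonneg fun _ _ => pow_nonneg hs0.le _)
          fun h _ => hfac h
    _ = Real.exp (v * B) * (∏ h, (2 * (((suitors p f h).card : ℝ) + 1) / ((n + 1) * v))) *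
        (((n + 1).factorial : ℝ) ^ n * ∏ h, 1 / (((suitors p f h).card : ℝ) + 1)) := by
        rw [Finset.prod_mul_distrib, Finset.prod_mul_distrib, Finset.prod_const, Finset.card_univ,
          Fintype.card_fin]
        ring
    _ ≤ _ := by
        exact mul_le_mul_of_nonneg_right
          ((mul_le_mul_of_nonneg_left hprod (Real.exp_pos _).le).trans hexp) hW

open Classical Equiv in
/-- A high average rank of the partners of the hospitals is exponentially unlikely under
stability, if every hospital has many suitors. -/
theorem card_stableAt_le_hospSum {n : ℕ} (hn : 1 ≤ n) (p : Fin (n + 1) → Perm (Fin n))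
    (f : Fin n ↪ Fin (n + 1)) {κ B : ℝ} (hκ : 0 < κ) (hκn : κ ≤ n)
    (hB : 12 * (n : ℝ) ^ 2 ≤ κ * B) (hk : ∀ h, κ ≤ (suitors p f h).card) :
    ((Finset.univ.filter fun q : Fin n → Perm (Fin (n + 1)) =>
        StableAt p f q ∧ B ≤ (hospSum q f : ℝ)).card : ℝ) ≤
      Real.exp (-n) * (((n + 1).factorial : ℝ) ^ n *
        ∏ h, 1 / (((suitors p f h).card : ℝ) + 1)) := by
  have hn0 : (0 : ℝ) < n := by exact_mod_cast hn
  -- The place of a partner has a geometric tail of rate at least `κ / n`, so its exponential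
  -- moment at a quarter of this rate is bounded.
  set v := κ / (4 * n) with hv
  have hv0 : 0 < v := by positivity
  have hv1 : v ≤ 1 / 4 := by rw [hv, div_le_iff₀ (by positivity)]; linarith
  have hvB : 3 * n ≤ v * B := by
    rw [hv, div_mul_eq_mul_div, le_div_iff₀ (by positivity)]; linarith
  set s := Real.exp v with hs
  have hs0 : 0 < s := Real.exp_pos _
  have hs1 : s ≤ 1 + 2 * v := by
    have h1 := Real.add_one_le_exp (-v)
    have h2 : s * Real.exp (-v) = 1 := by rw [hs, ← Real.exp_add]; simp
    nlinarith
  have hmarkov : ((Finset.univ.filter fun q : Fin n → Perm (Fin (n + 1)) =>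
        StableAt p f q ∧ B ≤ (hospSum q f : ℝ)).card : ℝ) ≤ Real.exp (-(v * B)) *
      ∑ q : Fin n → Perm (Fin (n + 1)) with StableAt p f q, s ^ hospSum q f := by
    rw [Finset.mul_sum, ← Finset.filter_filter, Finset.card_eq_sum_ones, Nat.cast_sum,
      Finset.sum_filter]
    refine Finset.sum_le_sum fun q _ => ?_
    split_ifs with h
    · rw [hs, ← Real.exp_nat_mul, ← Real.exp_add, Nat.cast_one, Real.one_le_exp_iff]
      nlinarith
    · positivity
  have hfac : ∀ h, ∑ τ : Perm (Fin (n + 1)) with ∀ d ∈ suitors p f h, τ (f h) < τ d,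
      s ^ (τ (f h) : ℕ) ≤ ((n + 1).factorial : ℝ) *
        (1 / (((suitors p f h).card : ℝ) + 1)) * 4 := by
    intro h
    set k : ℝ := ((suitors p f h).card : ℝ) with hkdef
    have hκk : κ ≤ k := hk h
    have hk1 : 1 ≤ k := by
      have : 0 < k := hκ.trans_le hκk
      rw [hkdef] at this ⊢
      exact_mod_cast this
    have hkn : k ≤ n := by
      have := Finset.card_le_univ (insert (f h) (suitors p f h))
      rw [Finset.card_insert_of_notMem (notMem_suitors_self p f h), Fintype.card_fin] at this
      rw [hkdef]
      exact_mod_cast Nat.le_of_succ_le_succ this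
    have hx0 : 0 ≤ 1 - k / n := by rw [sub_nonneg, div_le_one hn0]; exact hkn
    have h2v : 2 * v ≤ k / (2 * n) := by
      rw [hv, ← mul_div_assoc, div_le_div_iff₀ (by positivity) (by positivity)]
      nlinarith
    have hsx : s * (1 - k / n) ≤ 1 - k / (2 * n) := by
      have h1 : s * (1 - k / n) ≤ (1 + k / (2 * n)) * (1 - k / n) :=
        mul_le_mul_of_nonneg_right (by linarith) hx0
      have h2 : k / n = 2 * (k / (2 * n)) := by field_simp
      rw [h2] at h1 ⊢
      nlinarith [sq_nonneg (k / (2 * n))]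
    have hk2 : 0 < k / (2 * n) := by positivity
    refine (sum_perm_lt_all_pow_le hn (f h) _ (notMem_suitors_self p f h) hs0.le
      (by linarith)).trans ?_
    calc (n.factorial : ℝ) / (1 - s * (1 - k / n))
        ≤ n.factorial / (k / (2 * n)) := by gcongr; linarith
      _ ≤ _ := by
        rw [Nat.factorial_succ]
        push_cast
        have h3 : 1 / (k / (2 * n)) ≤ (n + 1) * (1 / (k + 1)) * 4 := by
          rw [one_div_div, mul_one_div, div_mul_eq_mul_div,
            div_le_div_iff₀ (by linarith) (by linarith)]
          nlinarith
        calc (n.factorial : ℝ) / (k / (2 * n)) = n.factorial * (1 / (k / (2 * n))) := by ring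
          _ ≤ n.factorial * ((n + 1) * (1 / (k + 1)) * 4) := by gcongr
          _ = _ := by ring
  have hexp : Real.exp (-(v * B)) * (4 : ℝ) ^ n ≤ Real.exp (-n) := by
    have h1 : (4 : ℝ) ≤ Real.exp 2 := by
      have := Real.exp_one_gt_d9
      rw [show (2 : ℝ) = 1 + 1 by norm_num, Real.exp_add]
      nlinarith
    calc Real.exp (-(v * B)) * (4 : ℝ) ^ n ≤ Real.exp (-(3 * n)) * Real.exp 2 ^ n := by gcongr
      _ = Real.exp (-n) := by rw [← Real.exp_nat_mul, ← Real.exp_add]; congr 1; ring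
  have hW : (0 : ℝ) ≤ ((n + 1).factorial : ℝ) ^ n *
      ∏ h, 1 / (((suitors p f h).card : ℝ) + 1) :=
    mul_nonneg (by positivity) (Finset.prod_nonneg fun _ _ => by positivity)
  rw [sum_stableAt_pow] at hmarkov
  refine hmarkov.trans ?_
  calc _ ≤ Real.exp (-(v * B)) * ∏ h, (((n + 1).factorial : ℝ) *
        (1 / (((suitors p f h).card : ℝ) + 1)) * 4) := by
        refine mul_le_mul_of_nonneg_left ?_ (Real.exp_pos _).le
        exact Finset.prod_le_prod (fun h _ => Finset.sum_nonneg fun _ _ => pow_nonneg hs0.le _)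
          fun h _ => hfac h
    _ = Real.exp (-(v * B)) * (4 : ℝ) ^ n *
        (((n + 1).factorial : ℝ) ^ n * ∏ h, 1 / (((suitors p f h).card : ℝ) + 1)) := by
        rw [Finset.prod_mul_distrib, Finset.prod_mul_distrib, Finset.prod_const, Finset.prod_const,
          Finset.card_univ, Fintype.card_fin]
        ring
    _ ≤ _ := mul_le_mul_of_nonneg_right hexp hW

/-! ### The first moment over all assignments -/

/-- Both place sums have their typical order of magnitude: `n ^ 2 / log n` for the doctors and
`n * log n` for the hospitals. -/
def Typical {n : ℕ} (p : Fin (n + 1) → Equiv.Perm (Fin n)) (f : Fin n ↪ Fin (n + 1))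
    (q : Fin n → Equiv.Perm (Fin (n + 1))) : Prop :=
  ((n : ℝ) ^ 2 / (32 * Real.log n) ≤ placeSum p f ∧
    (placeSum p f : ℝ) ≤ 2 * (n : ℝ) ^ 2 / Real.log n) ∧
  n * Real.log n / 48 ≤ hospSum q f ∧ (hospSum q f : ℝ) ≤ 1536 * (n * Real.log n)

open Classical in
/-- The factor gained over `weightBound` by asking a stable assignment with place sum `S` to be
atypical; nothing is gained if `S` itself is atypical, where `expectedBound` is already small. -/
noncomputable def atypicalFactor (n S : ℕ) : ℝ :=
  if (n : ℝ) ^ 2 / (32 * Real.log n) ≤ S ∧ (S : ℝ) ≤ 2 * (n : ℝ) ^ 2 / Real.log n then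
    2 * Real.exp (-n) + n * (n + 1) * Real.exp (-(n / (128 * Real.log n)))
  else 1

open Classical Equiv in
/-- For lists of the doctors with a typical place sum, an atypical stable assignment requires a
hospital with few suitors or an exponentially unlikely sum of ranks at the hospitals. -/
theorem card_atypical_le {n : ℕ} (hn : 2 ≤ n) (h48 : 48 ≤ Real.log n)
    (hlog : 128 * Real.log n ≤ n) (f : Fin n ↪ Fin (n + 1)) (p : Fin (n + 1) → Perm (Fin n))
    (hp : (n : ℝ) ^ 2 / (32 * Real.log n) ≤ placeSum p f ∧
      (placeSum p f : ℝ) ≤ 2 * (n : ℝ) ^ 2 / Real.log n) :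
    ((Finset.univ.filter fun q : Fin n → Perm (Fin (n + 1)) =>
        StableAt p f q ∧ ¬ Typical p f q).card : ℝ) ≤
      ((n + 1).factorial : ℝ) ^ n * (2 * Real.exp (-n) *
          (∏ h, 1 / (((suitors p f h).card : ℝ) + 1)) +
        ∑ j, if ((suitors p f j).card : ℝ) ≤ n / (128 * Real.log n) then
          ∏ h, 1 / (((suitors p f h).card : ℝ) + 1) else 0) := by
  have hn0 : (0 : ℝ) < n := by exact_mod_cast (by omega : 0 < n)
  have hl0 : 0 < Real.log n := by linarith
  generalize hW : ∏ h, 1 / (((suitors p f h).card : ℝ) + 1) = W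
  have hW0 : 0 ≤ W := hW ▸ Finset.prod_nonneg fun _ _ => by positivity
  set κ : ℝ := n / (128 * Real.log n) with hκ
  have hite : ∀ j, 0 ≤ if ((suitors p f j).card : ℝ) ≤ κ then W else 0 := by
    intro j; split_ifs <;> [exact hW0; exact le_rfl]
  have hexp := (Real.exp_pos (-(n : ℝ))).le
  by_cases hj : ∃ j, ((suitors p f j).card : ℝ) ≤ κ
  · obtain ⟨j, hj⟩ := hj
    have h1 : ((Finset.univ.filter fun q : Fin n → Perm (Fin (n + 1)) =>
        StableAt p f q ∧ ¬ Typical p f q).card : ℝ) ≤ ((n + 1).factorial : ℝ) ^ n * W := by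
      rw [← hW, ← card_stableAt]
      exact_mod_cast Finset.card_le_card fun q hq => by simp at hq ⊢; exact hq.1
    have hW' : W ≤ ∑ j, if ((suitors p f j).card : ℝ) ≤ κ then W else 0 :=
      (if_pos hj).symm.le.trans (Finset.single_le_sum
        (f := fun j => if ((suitors p f j).card : ℝ) ≤ κ then W else 0)
        (fun j _ => hite j) (Finset.mem_univ j))
    refine h1.trans (mul_le_mul_of_nonneg_left ?_ (pow_nonneg (Nat.cast_nonneg _) _))
    exact hW'.trans (le_add_of_nonneg_left (mul_nonneg (by linarith) hW0))
  · push Not at hj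
    -- `v` is as small as `S + 2 n ≤ 3 n ^ 2 / log n` permits, and `v * B = n` determines `B`.
    have hlow := card_stableAt_hospSum_le (by omega) p f (v := 48 / Real.log n)
      (B := n * Real.log n / 48) (by positivity) ((div_le_one hl0).mpr h48)
      (le_of_eq (by field_simp)) (by
        have h1 : 2 * (n : ℝ) ≤ (n : ℝ) ^ 2 / Real.log n := by
          rw [le_div_iff₀ hl0]; nlinarith
        have h2 : (n : ℝ) * ((n + 1) * (48 / Real.log n)) =
            48 * ((n : ℝ) ^ 2 / Real.log n) + 48 * (n / Real.log n) := by
          field_simp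
        have h3 : 0 ≤ (n : ℝ) / Real.log n := by positivity
        have h4 := hp.2
        rw [mul_div_assoc] at h4
        rw [h2]
        linarith)
    have hhigh := card_stableAt_le_hospSum (by omega) p f (κ := κ)
      (B := 1536 * (n * Real.log n)) (by positivity)
      (by
        rw [hκ, div_le_iff₀ (by positivity)]
        nlinarith)
      (le_of_eq (by rw [hκ]; field_simp; norm_num)) (fun h => (hj h).le)
    have hsub : (Finset.univ.filter fun q : Fin n → Perm (Fin (n + 1)) =>
        StableAt p f q ∧ ¬ Typical p f q) ⊆
        (Finset.univ.filter fun q : Fin n → Perm (Fin (n + 1)) =>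
          StableAt p f q ∧ (hospSum q f : ℝ) ≤ n * Real.log n / 48) ∪
        (Finset.univ.filter fun q : Fin n → Perm (Fin (n + 1)) =>
          StableAt p f q ∧ 1536 * (n * Real.log n) ≤ (hospSum q f : ℝ)) := by
      intro q hq
      simp only [Finset.mem_filter, Finset.mem_univ, true_and, Finset.mem_union] at hq ⊢
      obtain ⟨h1, h2⟩ := hq
      by_contra hcon
      push Not at hcon
      exact h2 ⟨hp, (hcon.1 h1).le, (hcon.2 h1).le⟩
    rw [hW] at hlow hhigh
    have hcard := (Finset.card_le_card hsub).trans (Finset.card_union_le _ _)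
    have hcard' := (Nat.cast_le (α := ℝ)).mpr hcard
    rw [Nat.cast_add] at hcard'
    have hsum : 0 ≤ ∑ j, if ((suitors p f j).card : ℝ) ≤ κ then W else 0 :=
      Finset.sum_nonneg fun j _ => hite j
    calc _ ≤ _ := hcard'
      _ ≤ Real.exp (-n) * (((n + 1).factorial : ℝ) ^ n * W) +
          Real.exp (-n) * (((n + 1).factorial : ℝ) ^ n * W) := add_le_add hlow hhigh
      _ = ((n + 1).factorial : ℝ) ^ n * (2 * Real.exp (-n) * W + 0) := by ring
      _ ≤ _ := by gcongr

open Classical Equiv in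
theorem sum_card_atypical_le {n : ℕ} (hn : 2 ≤ n) (h48 : 48 ≤ Real.log n)
    (hlog : 128 * Real.log n ≤ n) (f : Fin n ↪ Fin (n + 1)) (S : ℕ) :
    ∑ p : Fin (n + 1) → Perm (Fin n) with placeSum p f = S,
        ((Finset.univ.filter fun q : Fin n → Perm (Fin (n + 1)) =>
          StableAt p f q ∧ ¬ Typical p f q).card : ℝ) ≤
      ((n + 1).factorial : ℝ) ^ n * (atypicalFactor n S * weightBound n S) := by
  have hn0 : (0 : ℝ) < n := by exact_mod_cast (by omega : 0 < n)
  have hl0 : 0 < Real.log n := by linarith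
  have hWB := weightBound_nonneg hn S
  rw [atypicalFactor]
  split_ifs with hS
  · have h1 : ∑ p : Fin (n + 1) → Perm (Fin n) with placeSum p f = S,
        ((Finset.univ.filter fun q : Fin n → Perm (Fin (n + 1)) =>
          StableAt p f q ∧ ¬ Typical p f q).card : ℝ) ≤
        ∑ p : Fin (n + 1) → Perm (Fin n) with placeSum p f = S,
          ((n + 1).factorial : ℝ) ^ n * (2 * Real.exp (-n) *
            (∏ h, 1 / (((suitors p f h).card : ℝ) + 1)) +
          ∑ j, if ((suitors p f j).card : ℝ) ≤ n / (128 * Real.log n) then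
            ∏ h, 1 / (((suitors p f h).card : ℝ) + 1) else 0) := by
      refine Finset.sum_le_sum fun p hp => card_atypical_le hn h48 hlog f p ?_
      rw [(Finset.mem_filter.mp hp).2]
      exact hS
    refine h1.trans ?_
    rw [← Finset.mul_sum, Finset.sum_add_distrib, ← Finset.mul_sum, Finset.sum_comm]
    refine mul_le_mul_of_nonneg_left ?_ (by positivity)
    rw [add_mul]
    refine add_le_add (mul_le_mul_of_nonneg_left
      (sum_prod_suitors_le_weightBound hn S f) (by positivity)) ?_
    refine (Finset.sum_le_card_nsmul _ _ ((n + 1) * Real.exp (-(n / (128 * Real.log n))) *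
      weightBound n S) fun j _ => ?_).trans (le_of_eq (by simp; ring))
    refine (sum_prod_suitors_few_le hn S f j _).trans (mul_le_mul_of_nonneg_right ?_ hWB)
    rw [mul_comm ((n : ℝ) + 1)]
    refine mul_le_mul_of_nonneg_right ?_ (by positivity)
    -- `S / (2 n)` is at least `n / (64 log n)`, twice the exponent of the factor `2 ^ κ`
    have h2 : (2 : ℝ) ^ ((n : ℝ) / (128 * Real.log n)) ≤ Real.exp (n / (128 * Real.log n)) := by
      rw [← Real.exp_one_rpow]
      have := Real.add_one_le_exp 1
      exact Real.rpow_le_rpow (by norm_num) (by linarith) (by positivity)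
    refine (mul_le_mul_of_nonneg_right h2 (Real.exp_pos _).le).trans ?_
    rw [← Real.exp_add]
    refine Real.exp_le_exp.mpr ?_
    have h3 : (n : ℝ) / (128 * Real.log n) * 2 ≤ S / (2 * n) := by
      rw [le_div_iff₀ (by positivity)]
      refine le_trans (le_of_eq ?_) hS.1
      field_simp
      norm_num
    linarith
  · rw [one_mul]
    refine le_trans ?_ (mul_le_mul_of_nonneg_left (sum_prod_suitors_le_weightBound hn S f)
      (by positivity))
    rw [Finset.mul_sum]
    refine Finset.sum_le_sum fun p _ => ?_
    rw [← card_stableAt]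
    exact_mod_cast Finset.card_le_card fun q hq => by simp at hq ⊢; exact hq.1

theorem atypicalFactor_mul_expectedBound_le {n : ℕ} (hn : 2 ≤ n) (h48 : 48 ≤ Real.log n)
    (hlog : 128 * Real.log n ≤ n) (S : ℕ) :
    atypicalFactor n S * expectedBound n S ≤ Real.exp 2 * (n * (n + 1)) *
      (Real.exp (-(8 * Real.log n)) + Real.exp (-(n * Real.exp (-(Real.log n / 2)))) +
        2 * Real.exp (-n) + n * (n + 1) * Real.exp (-(n / (128 * Real.log n)))) := by
  have hn0 : (0 : ℝ) < n := by exact_mod_cast (by omega : 0 < n)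
  have hl0 : 0 < Real.log n := by linarith
  have hE := expectedBound_nonneg hn S
  have e1 := Real.exp_pos (-(8 * Real.log n))
  have e2 := Real.exp_pos (-(n * Real.exp (-(Real.log n / 2))))
  have e3 := Real.exp_pos (-(n : ℝ))
  have e4 : 0 < n * (n + 1) * Real.exp (-(n / (128 * Real.log n))) := by positivity
  rw [atypicalFactor]
  split_ifs with hS
  · rw [mul_comm]
    refine mul_le_mul ?_ (by linarith) (by positivity) (by positivity)
    refine (expectedBound_le_exp hn S).trans (mul_le_of_le_one_right (by positivity) ?_)
    rw [Real.exp_le_one_iff, Left.neg_nonpos_iff]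
    positivity
  · rw [one_mul]
    by_cases h1 : (n : ℝ) ^ 2 / (32 * Real.log n) ≤ S
    · have h2 : 2 * (n : ℝ) ^ 2 / Real.log n < S := by
        by_contra hcon; exact hS ⟨h1, not_lt.mp hcon⟩
      have hS0 : (0 : ℝ) < S := lt_of_le_of_lt (by positivity) h2
      refine (expectedBound_le_exp_exp hn (by exact_mod_cast hS0)).trans
        (mul_le_mul_of_nonneg_left ?_ (by positivity))
      have h3 : (n : ℝ) ^ 2 / S ≤ Real.log n / 2 := by
        rw [div_lt_iff₀ hl0] at h2
        rw [div_le_div_iff₀ hS0 (by norm_num)]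
        linarith
      have h4 : Real.exp (-(n * Real.exp (-((n : ℝ) ^ 2 / S)))) ≤
          Real.exp (-(n * Real.exp (-(Real.log n / 2)))) := by gcongr
      linarith
    · refine (expectedBound_le_exp hn S).trans
        (mul_le_mul_of_nonneg_left ?_ (by positivity))
      have h3 : 8 * Real.log n ≤ (n : ℝ) ^ 2 / (2 * (S + n)) := by
        rw [not_le, lt_div_iff₀ (by positivity)] at h1
        rw [le_div_iff₀ (by positivity)]
        nlinarith
      have h4 : Real.exp (-((n : ℝ) ^ 2 / (2 * (S + n)))) ≤ Real.exp (-(8 * Real.log n)) := by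
        gcongr
      linarith

theorem placeSum_lt {n : ℕ} (p : Fin (n + 1) → Equiv.Perm (Fin n)) (f : Fin n ↪ Fin (n + 1)) :
    placeSum p f < n ^ 2 + 1 := by
  have : placeSum p f ≤ ∑ _h : Fin n, n := Finset.sum_le_sum fun h _ => (p (f h) h).isLt.le
  simp at this
  nlinarith

/-- The first-moment bound for the probability that some assignment is stable and atypical. -/
noncomputable def errorBound (n : ℕ) : ℝ :=
  ((n : ℝ) ^ 2 + 1) * (Real.exp 2 * (n * (n + 1)) *
    (Real.exp (-(8 * Real.log n)) + Real.exp (-(n * Real.exp (-(Real.log n / 2)))) +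
      2 * Real.exp (-n) + n * (n + 1) * Real.exp (-(n / (128 * Real.log n)))))

open Classical in
theorem card_exists_atypical_le {n : ℕ} (hn : 2 ≤ n) (h48 : 48 ≤ Real.log n)
    (hlog : 128 * Real.log n ≤ n) :
    ((Finset.univ.filter fun P : Market (n + 1) n =>
        ∃ f : Fin n ↪ Fin (n + 1), StableAt P.1 f P.2 ∧ ¬ Typical P.1 f P.2).card : ℝ) /
        ((n.factorial : ℝ) ^ (n + 1) * ((n + 1).factorial : ℝ) ^ n) ≤ errorBound n := by
  have hunion : ((Finset.univ.filter fun P : Market (n + 1) n =>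
        ∃ f : Fin n ↪ Fin (n + 1), StableAt P.1 f P.2 ∧ ¬ Typical P.1 f P.2).card : ℝ) ≤
      ∑ f : Fin n ↪ Fin (n + 1), ((Finset.univ.filter fun P : Market (n + 1) n =>
        StableAt P.1 f P.2 ∧ ¬ Typical P.1 f P.2).card : ℝ) := by
    have : (Finset.univ.filter fun P : Market (n + 1) n =>
        ∃ f : Fin n ↪ Fin (n + 1), StableAt P.1 f P.2 ∧ ¬ Typical P.1 f P.2) =
        Finset.univ.biUnion fun f : Fin n ↪ Fin (n + 1) =>
          Finset.univ.filter fun P : Market (n + 1) n =>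
            StableAt P.1 f P.2 ∧ ¬ Typical P.1 f P.2 := by
      ext P; simp
    rw [this]
    exact_mod_cast Finset.card_biUnion_le
  have hf : ∀ f : Fin n ↪ Fin (n + 1), ((Finset.univ.filter fun P : Market (n + 1) n =>
      StableAt P.1 f P.2 ∧ ¬ Typical P.1 f P.2).card : ℝ) ≤
      ∑ S ∈ Finset.range (n ^ 2 + 1),
        ((n + 1).factorial : ℝ) ^ n * (atypicalFactor n S * weightBound n S) := by
    intro f
    have h1 : ((Finset.univ.filter fun P : Market (n + 1) n =>
        StableAt P.1 f P.2 ∧ ¬ Typical P.1 f P.2).card : ℝ) =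
        ∑ p, ((Finset.univ.filter fun q : Fin n → Equiv.Perm (Fin (n + 1)) =>
          StableAt p f q ∧ ¬ Typical p f q).card : ℝ) := by
      simp only [Finset.card_eq_sum_ones, Finset.sum_filter, Nat.cast_sum]
      rw [Fintype.sum_prod_type]
    rw [h1, ← Finset.sum_fiberwise_of_maps_to (t := Finset.range (n ^ 2 + 1))
      (g := fun p => placeSum p f) fun p _ => Finset.mem_range.mpr (placeSum_lt p f)]
    exact Finset.sum_le_sum fun S _ => sum_card_atypical_le hn h48 hlog f S
  have hnum : Fintype.card (Fin n ↪ Fin (n + 1)) = (n + 1).factorial := by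
    rw [Fintype.card_embedding_eq, Fintype.card_fin, Fintype.card_fin]
    have := Nat.factorial_mul_descFactorial (Nat.le_succ n)
    simpa using this
  have hN : (0 : ℝ) < (n.factorial : ℝ) ^ (n + 1) * ((n + 1).factorial : ℝ) ^ n := by positivity
  rw [div_le_iff₀ hN]
  refine hunion.trans ((Finset.sum_le_sum fun f _ => hf f).trans ?_)
  rw [Finset.sum_const, Finset.card_univ, hnum, nsmul_eq_mul]
  have h1 : ∑ S ∈ Finset.range (n ^ 2 + 1), atypicalFactor n S * expectedBound n S ≤
      errorBound n := by
    refine (Finset.sum_le_card_nsmul _ _ _ fun S _ =>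
      atypicalFactor_mul_expectedBound_le hn h48 hlog S).trans (le_of_eq ?_)
    rw [Finset.card_range, nsmul_eq_mul, errorBound]
    push_cast
    ring
  refine le_trans (le_of_eq ?_) (mul_le_mul_of_nonneg_right h1 hN.le)
  rw [Finset.mul_sum, Finset.sum_mul]
  refine Finset.sum_congr rfl fun S _ => ?_
  rw [expectedBound]
  field_simp

theorem randomMarket_real {n : ℕ} (B : Finset (Market (n + 1) n)) :
    (randomMarket (n + 1) n).real B =
      B.card / ((n.factorial : ℝ) ^ (n + 1) * ((n + 1).factorial : ℝ) ^ n) := by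
  have hprob : ∀ k, IsProbabilityMeasure (uniformPerm k) := fun k => by
    unfold uniformPerm; infer_instance
  have hu : ∀ (k : ℕ) (σ : Equiv.Perm (Fin k)),
      (uniformPerm k) {σ} = (k.factorial : ENNReal)⁻¹ := by
    intro k σ
    rw [uniformPerm, uniformOn_univ, Measure.count_singleton, one_div, Fintype.card_perm,
      Fintype.card_fin]
  have hprob' : IsProbabilityMeasure (randomMarket (n + 1) n) := by
    unfold randomMarket; infer_instance
  have hsing : ∀ P : Market (n + 1) n, (randomMarket (n + 1) n).real {P} =
      1 / ((n.factorial : ℝ) ^ (n + 1) * ((n + 1).factorial : ℝ) ^ n) := by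
    rintro ⟨p, q⟩
    rw [Measure.real, randomMarket, ← Set.singleton_prod_singleton, Measure.prod_prod,
      Measure.pi_singleton, Measure.pi_singleton]
    simp [hu]
    ring
  rw [← sum_measureReal_singleton, Finset.sum_congr rfl fun P _ => hsing P, Finset.sum_const,
    nsmul_eq_mul, mul_one_div]

theorem tendsto_errorBound : Tendsto errorBound atTop (𝓝 0) := by
  have hsqrt : Tendsto (fun n : ℕ => √(n : ℝ)) atTop atTop :=
    Real.tendsto_sqrt_atTop.comp tendsto_natCast_atTop_atTop
  -- an upper bound with `x = √n`, using `log n ≤ √n / 128`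
  have hlim : Tendsto (fun n : ℕ => 4 * Real.exp 2 * (((n : ℝ) ^ 4)⁻¹ +
      5 * (√(n : ℝ) ^ 12 * Real.exp (-√(n : ℝ))))) atTop (𝓝 0) := by
    have h1 : Tendsto (fun n : ℕ => ((n : ℝ) ^ 4)⁻¹) atTop (𝓝 0) :=
      ((tendsto_pow_atTop (by norm_num)).comp tendsto_natCast_atTop_atTop).inv_tendsto_atTop
    have h2 := (Real.tendsto_pow_mul_exp_neg_atTop_nhds_zero 12).comp hsqrt
    have h3 := (h1.add (h2.const_mul 5)).const_mul (4 * Real.exp 2)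
    simpa using h3
  have hlog : ∀ᶠ n : ℕ in atTop, 128 * Real.log n ≤ √(n : ℝ) := by
    have h1 := (isLittleO_log_rpow_atTop (r := 1 / 2) (by norm_num)).bound
      (show (0 : ℝ) < 1 / 128 by norm_num)
    filter_upwards [tendsto_natCast_atTop_atTop.eventually h1, eventually_ge_atTop 1] with n hn hn1
    have hn1' : (1 : ℝ) ≤ n := by exact_mod_cast hn1
    rw [Real.norm_of_nonneg (Real.log_nonneg hn1'), Real.norm_of_nonneg (by positivity),
      ← Real.sqrt_eq_rpow] at hn
    linarith
  refine tendsto_of_tendsto_of_tendsto_of_le_of_le' tendsto_const_nhds hlim ?_ ?_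
  · refine Eventually.of_forall fun n => ?_
    unfold errorBound
    positivity
  · filter_upwards [hlog, eventually_ge_atTop 2] with n hln hn
    have hn2 : (2 : ℝ) ≤ n := by exact_mod_cast hn
    have hn0 : (0 : ℝ) < n := by linarith
    have hl0 : 0 < Real.log n := Real.log_pos (by linarith)
    set x := √(n : ℝ) with hx
    have hx0 : 0 < x := Real.sqrt_pos.mpr hn0
    have hxx : x * x = n := Real.mul_self_sqrt hn0.le
    have hx1 : 1 ≤ x := by nlinarith
    have e1 : Real.exp (-(8 * Real.log n)) = ((n : ℝ) ^ 8)⁻¹ := by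
      rw [Real.exp_neg, show (8 : ℝ) * Real.log n = ((8 : ℕ) : ℝ) * Real.log n by norm_num,
        Real.exp_nat_mul, Real.exp_log hn0]
    have e2 : Real.exp (-(n * Real.exp (-(Real.log n / 2)))) = Real.exp (-x) := by
      have h1 : Real.exp (-(Real.log n / 2)) = x⁻¹ := by
        rw [Real.exp_neg, hx, Real.sqrt_eq_rpow, Real.rpow_def_of_pos hn0]
        congr 2
        ring
      rw [h1, ← hxx]
      congr 2
      field_simp
    have e3 : Real.exp (-(n : ℝ)) ≤ Real.exp (-x) := by
      refine Real.exp_le_exp.mpr ?_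
      nlinarith
    have e4 : Real.exp (-(n / (128 * Real.log n))) ≤ Real.exp (-x) := by
      refine Real.exp_le_exp.mpr (neg_le_neg ?_)
      rw [le_div_iff₀ (by positivity)]
      exact (mul_le_mul_of_nonneg_left hln hx0.le).trans hxx.le
    have hE := Real.exp_pos (-x)
    have hpoly : (n : ℝ) * (n + 1) ≤ 2 * (n : ℝ) ^ 2 := by nlinarith
    have hsum : Real.exp (-(8 * Real.log n)) + Real.exp (-(n * Real.exp (-(Real.log n / 2)))) +
        2 * Real.exp (-n) + n * (n + 1) * Real.exp (-(n / (128 * Real.log n))) ≤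
        ((n : ℝ) ^ 8)⁻¹ + 5 * ((n : ℝ) ^ 2 * Real.exp (-x)) := by
      rw [e1, e2]
      have h1 : n * (n + 1) * Real.exp (-(n / (128 * Real.log n))) ≤
          2 * (n : ℝ) ^ 2 * Real.exp (-x) := by gcongr
      have h2 : 1 * Real.exp (-x) ≤ (n : ℝ) ^ 2 * Real.exp (-x) := by
        refine mul_le_mul_of_nonneg_right ?_ hE.le
        nlinarith
      linarith
    have hx12 : x ^ 12 = (n : ℝ) ^ 6 := by rw [← hxx]; ring
    unfold errorBound
    calc _ ≤ (2 * (n : ℝ) ^ 2) * (Real.exp 2 * (2 * (n : ℝ) ^ 2) *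
          (((n : ℝ) ^ 8)⁻¹ + 5 * ((n : ℝ) ^ 2 * Real.exp (-x)))) := by
          gcongr
          nlinarith
      _ = _ := by
          rw [hx12]
          field_simp
          ring

/-! ### From place sums to average ranks -/

theorem pairs_some {m n : ℕ} (f : Fin n ↪ Fin m) :
    pairs (fun h => some (f h)) =
      Finset.univ.image fun h => (f h, h) := by
  ext ⟨d, h⟩
  simp only [pairs, Finset.mem_filter, Finset.mem_univ, true_and, Option.some.injEq,
    Finset.mem_image, Prod.mk.injEq]
  exact ⟨fun hd => ⟨h, hd, rfl⟩, fun ⟨_, hd, hh⟩ => hh ▸ hd⟩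

theorem avgHospRank_some {m n : ℕ} (hn : 1 ≤ n) (P : Market m n) (f : Fin n ↪ Fin m) :
    P.avgHospRank (fun h => some (f h)) = hospSum P.2 f / n + 1 := by
  have hn0 : (n : ℝ) ≠ 0 := by exact_mod_cast (by omega : n ≠ 0)
  rw [Market.avgHospRank, pairs_some,
    Finset.sum_image fun _ _ _ _ h => (Prod.ext_iff.mp h).2,
    Finset.card_image_of_injective _ fun _ _ h => (Prod.ext_iff.mp h).2, Finset.card_univ,
    Fintype.card_fin]
  simp [Market.hospRank, hospSum, Finset.sum_add_distrib, add_div, hn0]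

theorem avgDocRank_some {m n : ℕ} (hn : 1 ≤ n) (P : Market m n) (f : Fin n ↪ Fin m) :
    P.avgDocRank (fun h => some (f h)) = placeSum P.1 f / n + 1 := by
  have hn0 : (n : ℝ) ≠ 0 := by exact_mod_cast (by omega : n ≠ 0)
  rw [Market.avgDocRank, pairs_some,
    Finset.sum_image fun _ _ _ _ h => (Prod.ext_iff.mp h).2,
    Finset.card_image_of_injective _ fun _ _ h => (Prod.ext_iff.mp h).2, Finset.card_univ,
    Fintype.card_fin]
  simp [Market.docRank, placeSum, Finset.sum_add_distrib, add_div, hn0]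

theorem avgHospRank_mem_of_typical {n : ℕ} (hn : 2 ≤ n) (h48 : 48 ≤ Real.log n)
    {P : Market (n + 1) n} {f : Fin n ↪ Fin (n + 1)} (hT : Typical P.1 f P.2) :
    1 / 48 * Real.log n ≤ P.avgHospRank (fun h => some (f h)) ∧
      P.avgHospRank (fun h => some (f h)) ≤ 1537 * Real.log n := by
  have hn0 : (0 : ℝ) < n := by exact_mod_cast (by omega : 0 < n)
  obtain ⟨-, h1, h2⟩ := hT
  rw [avgHospRank_some (by omega)]
  have h3 : Real.log n / 48 ≤ hospSum P.2 f / n := by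
    rw [le_div_iff₀ hn0]; linarith
  have h4 : (hospSum P.2 f : ℝ) / n ≤ 1536 * Real.log n := by
    rw [div_le_iff₀ hn0]; linarith
  constructor <;> linarith

theorem avgDocRank_mem_of_typical {n : ℕ} (hn : 2 ≤ n) (h48 : 48 ≤ Real.log n)
    (hlog : 128 * Real.log n ≤ n) {P : Market (n + 1) n} {f : Fin n ↪ Fin (n + 1)}
    (hT : Typical P.1 f P.2) :
    1 / 48 * (n / Real.log n) ≤ P.avgDocRank (fun h => some (f h)) ∧
      P.avgDocRank (fun h => some (f h)) ≤ 1537 * (n / Real.log n) := by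
  have hn0 : (0 : ℝ) < n := by exact_mod_cast (by omega : 0 < n)
  have hl0 : 0 < Real.log n := by linarith
  obtain ⟨⟨h1, h2⟩, -⟩ := hT
  rw [avgDocRank_some (by omega)]
  have h0 : 1 ≤ n / Real.log n := by rw [le_div_iff₀ hl0]; linarith
  have h3 : 1 / 32 * (n / Real.log n) ≤ placeSum P.1 f / n := by
    rw [le_div_iff₀ hn0]
    refine le_trans (le_of_eq ?_) h1
    field_simp
  have h4 : (placeSum P.1 f : ℝ) / n ≤ 2 * (n / Real.log n) := by
    rw [div_le_iff₀ hn0]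
    refine h2.trans (le_of_eq ?_)
    field_simp
  constructor <;> linarith

end StableMatching

theorem mainTheorem1 :
    ∃ c C : ℝ, 0 < c ∧ 0 < C ∧
      Tendsto
        (fun n : ℕ => StableMatching.randomMarket (n + 1) n
          {P : StableMatching.Market (n + 1) n |
            P.DAHalts ∧ (∃ μ, P.DAOutputs μ) ∧
            ∀ μ, P.DAOutputs μ →
              P.IsStable μ ∧ (∀ h, ∃ d, μ h = some d) ∧
              (c * Real.log n ≤ P.avgHospRank μ ∧ P.avgHospRank μ ≤ C * Real.log n) ∧
              (c * (n / Real.log n) ≤ P.avgDocRank μ ∧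
                P.avgDocRank μ ≤ C * (n / Real.log n))})
        atTop (𝓝 1) := by
  classical
  refine ⟨1 / 48, 1537, by norm_num, by norm_num, ?_⟩
  have hlower : Tendsto (fun n : ℕ => ENNReal.ofReal (1 - StableMatching.errorBound n))
      atTop (𝓝 1) := by
    have h1 := ENNReal.tendsto_ofReal (StableMatching.tendsto_errorBound.const_sub 1)
    simpa using h1
  have hprob : ∀ n : ℕ, IsProbabilityMeasure (StableMatching.randomMarket (n + 1) n) := by
    intro n
    have : ∀ k, IsProbabilityMeasure (StableMatching.uniformPerm k) := fun k => by
      unfold StableMatching.uniformPerm; infer_instance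
    unfold StableMatching.randomMarket
    infer_instance
  refine tendsto_of_tendsto_of_tendsto_of_le_of_le' hlower tendsto_const_nhds ?_
    (Eventually.of_forall fun n => by have := hprob n; exact prob_le_one)
  have hlogTop : Tendsto (fun n : ℕ => Real.log n) atTop atTop :=
    Real.tendsto_log_atTop.comp tendsto_natCast_atTop_atTop
  have hlogle : ∀ᶠ n : ℕ in atTop, 128 * Real.log n ≤ n := by
    have h1 := Real.isLittleO_log_id_atTop.bound (show (0 : ℝ) < 1 / 128 by norm_num)
    filter_upwards [tendsto_natCast_atTop_atTop.eventually h1, eventually_ge_atTop 1] with n hn hn1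
    have hn1' : (1 : ℝ) ≤ n := by exact_mod_cast hn1
    rw [Real.norm_of_nonneg (Real.log_nonneg hn1'), id, Real.norm_of_nonneg (by positivity)] at hn
    linarith
  filter_upwards [hlogTop.eventually_ge_atTop 48, hlogle, eventually_ge_atTop 2] with n h48 hlog hn
  have := hprob n
  set bad : Finset (StableMatching.Market (n + 1) n) := Finset.univ.filter fun P =>
    ∃ f : Fin n ↪ Fin (n + 1), StableMatching.StableAt P.1 f P.2 ∧
      ¬ StableMatching.Typical P.1 f P.2 with hbad
  have hreal : (StableMatching.randomMarket (n + 1) n).real bad ≤ StableMatching.errorBound n := by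
    rw [StableMatching.randomMarket_real]
    exact StableMatching.card_exists_atypical_le hn h48 hlog
  have hcompl : 1 - StableMatching.errorBound n ≤
      (StableMatching.randomMarket (n + 1) n).real (bad : Set _)ᶜ := by
    rw [probReal_compl_eq_one_sub (Finset.measurableSet bad)]
    linarith
  calc ENNReal.ofReal (1 - StableMatching.errorBound n)
      ≤ ENNReal.ofReal ((StableMatching.randomMarket (n + 1) n).real (bad : Set _)ᶜ) :=
        ENNReal.ofReal_le_ofReal hcompl
    _ = StableMatching.randomMarket (n + 1) n (bad : Set _)ᶜ := by
        rw [Measure.real, ENNReal.ofReal_toReal (measure_ne_top _ _)]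
    _ ≤ _ := measure_mono fun P hP => ?_
  refine ⟨P.daHalts, P.exists_daOutputs, fun μ hμ => ?_⟩
  obtain ⟨hstable, f, rfl⟩ := hμ.exists_embedding
  have hT : StableMatching.Typical P.1 f P.2 := by
    by_contra hcon
    exact hP (by simpa [hbad] using ⟨f, hstable.stableAt, hcon⟩)
  exact ⟨hstable, fun h => ⟨f h, rfl⟩, StableMatching.avgHospRank_mem_of_typical hn h48 hT,
    StableMatching.avgDocRank_mem_of_typical hn h48 hlog hT⟩
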